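/- Let $d\ge 0$ be an integer and let $A\subsetneq\mathbb R^d$ be an open set with convex complement, with $\mathbf 0\notin\overline A$, and increasing: $\mathbf x+\mathbf a\in A$ whenever $\mathbf x\in A$ and $\mathbf a\in[0,\infty)^d$. For a random vector $\mathbf X$ with values in $[0,\infty)^d$ and distribution $F$, let $F_A$ be the distribution of $Y_A=\sup\{u\in\mathbb R:\mathbf X\in uA\}$, where $\sup\emptyset=0$. Write $\overline V(x)=V((x,\infty))$ for a probability distribution $V$. The following classes consist of probability distributions $V$ on $[0,\infty)$ with $\overline V(x)>0$ for all $x\ge 0$: - $V\in\mathcal L$ if $\overline V(x-a)/\overline V(x)\to 1$ as $x\to\infty$ for every $a>0$; - $V\in\mathcal S$ if $\overline{V*V}(x)/\overline V(x)\to 2$ as $x\to\infty$; - $V\in\mathcal D$ if $\limsup_{x\to\infty}\overline V(bx)/\overline V(x)<\infty$ for every $b\in(0,1)$; - $V\in\mathcal C$ if $\lim_{b\uparrow 1}\limsup_{x\to\infty}\overline V(bx)/\overline V(x)=1$. For each of the classes $\mathcal B\in\{\mathcal L,\ \mathcal D\cap\mathcal L,\ \mathcal C,\ \mathcal S\}$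 write $F\in\mathcal B_A$ if $F_A\in\mathcal B$. Let $\Theta$ be a non-negative random variable with distribution $Q$, not almost surely equal to $0$, and independent of $\mathbf X$. Let $G$ be the distribution of $\Theta\mathbf X$ and put $M_A=\sup\{u:\Theta\mathbf X\in uA\}$. For a distribution $V$ on $[0,\infty)$ let $D(V)=\{t>0: V(\{t\})>0\}$ be the set of its positive atoms, that is, of the positive discontinuity points of its distribution function. All asymptotic relations are as $x\to\infty$. **(I)** Assume that $\mathbb P[\Theta>cx]=o(\mathbb P[M_A>x])$ for every $c>0$. Then: 1. if $F\in\mathcal L_A$, then $G\in\mathcal L_A$; 2. if $F\in(\mathcal D\cap\mathcal L)_A$, then $G\in(\mathcal D\cap\mathcal L)_A$; 3. if $F\in\mathcal C_A$, then $G\in\mathcal C_A$; 4. if $F\in\mathcal S_A$, then $G\in\mathcal S_A$ if and only if either $D(Q)=\emptyset$, or $D(Q)\ne\emptyset$ and $$\overline Q\left(\frac xt\right)-\overline Q\left(\frac{x+1}t\right)=o(\mathbb P[M_A>x])\qquad\text{for every } t\in D(Q).$$ **(II)** Without the assumption made in (I): if $F\in\mathcal S_A$, then $G\in\mathcal S_A$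 if and only if either $D(F_A)=\emptyset$, or $D(F_A)\ne\emptyset$ and $$\overline Q\left(\frac xt\right)-\overline Q\left(\frac{x+1}t\right)=o(\mathbb P[M_A>x])\qquad\text{for every } t\in D(F_A).$$ -/

import Mathlib

open MeasureTheory ProbabilityTheory Filter Topology Set Asymptotics
open scoped Pointwise ENNReal

namespace HeavyTail

/-- The tail `x ↦ V((x, ∞))` of a distribution `V` on the real line. -/
noncomputable def tail (V : Measure ℝ) (x : ℝ) : ℝ := V.real (Ioi x)

/-- The standing conditions on a one-dimensional distribution: a probability measure carried by
`[0, ∞)` whose tail is positive everywhere on `[0, ∞)`. -/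
structure IsBase (V : Measure ℝ) : Prop where
  isProbabilityMeasure : IsProbabilityMeasure V
  support_nonneg : V (Iio 0) = 0
  tail_pos : ∀ x : ℝ, 0 ≤ x → 0 < tail V x

/-- The class `ℒ` of long-tailed distributions. -/
def LongTailed (V : Measure ℝ) : Prop :=
  IsBase V ∧ ∀ a : ℝ, 0 < a → Tendsto (fun x : ℝ => tail V (x - a) / tail V x) atTop (𝓝 1)

/-- The class `𝒮` of subexponential distributions (with the two-fold convolution). -/
def Subexponential (V : Measure ℝ) : Prop :=
  IsBase V ∧ Tendsto (fun x : ℝ => tail (Measure.conv V V) x / tail V x) atTop (𝓝 2)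

/-- The class `𝒟` of dominatedly varying distributions.  The upper limit is taken in `[0, ∞]`. -/
def DominatedlyVarying (V : Measure ℝ) : Prop :=
  IsBase V ∧ ∀ b : ℝ, 0 < b → b < 1 →
    limsup (fun x : ℝ => ENNReal.ofReal (tail V (b * x) / tail V x)) atTop < ⊤

/-- The class `𝒞` of consistently varying distributions.  The upper limit is taken in `[0, ∞]`. -/
def ConsistentlyVarying (V : Measure ℝ) : Prop :=
  IsBase V ∧
    Tendsto (fun b : ℝ =>
      limsup (fun x : ℝ => ENNReal.ofReal (tail V (b * x) / tail V x)) atTop) (𝓝[<] 1) (𝓝 1)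

/-- The set of positive atoms of a distribution on the real line, that is, of the positive
discontinuity points of its distribution function. -/
def posAtoms (V : Measure ℝ) : Set ℝ := {t : ℝ | 0 < t ∧ 0 < V {t}}

variable {d : ℕ}

/-- The family `ℛ` of open increasing proper subsets of `ℝ^d` with convex complement whose closure
does not contain the origin. -/
structure MemR (A : Set (Fin d → ℝ)) : Prop where
  ne_univ : A ≠ univ
  isOpen : IsOpen A
  increasing : ∀ x ∈ A, ∀ a : Fin d → ℝ, (∀ i, 0 ≤ a i) → x + a ∈ A
  convex_compl : Convex ℝ Aᶜ
  zero_notMem : (0 : Fin d → ℝ) ∉ closure A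

/-- `sup {u : x ∈ u A}`. -/
noncomputable def gaugeSup (A : Set (Fin d → ℝ)) (x : Fin d → ℝ) : ℝ :=
  sSup {u : ℝ | x ∈ u • A}

/-- The distribution `F_A` of `Y_A = sup {u : X ∈ u A}` when `X` has distribution `F`. -/
noncomputable def lawAlong (A : Set (Fin d → ℝ)) (F : Measure (Fin d → ℝ)) : Measure ℝ :=
  F.map (gaugeSup A)

/-- The supremum is over a set that is bounded above, so it is never a default value, except over
the empty set, where it is `0`. -/
theorem MemR.bddAbove {A : Set (Fin d → ℝ)} (hA : MemR A) (x : Fin d → ℝ) :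
    BddAbove {u : ℝ | x ∈ u • A} := by
  have hn : Aᶜ ∈ 𝓝 (0 : Fin d → ℝ) := by
    have := hA.zero_notMem
    rwa [← mem_compl_iff, ← interior_compl, mem_interior_iff_mem_nhds] at this
  have ht : Tendsto (fun u : ℝ => u⁻¹ • x) atTop (𝓝 0) := by
    have := (tendsto_inv_atTop_zero (𝕜 := ℝ)).smul_const x
    simpa using this
  obtain ⟨N, hN⟩ := eventually_atTop.1 (ht.eventually hn)
  refine ⟨max N 1, fun u hu => ?_⟩
  by_contra! h
  have h0 : u ≠ 0 := by
    have := le_max_right N 1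
    intro h0; linarith
  exact hN u ((le_max_left N 1).trans h.le) ((mem_smul_set_iff_inv_smul_mem₀ h0 A x).1 hu)

/-- The map is measurable, so that its image measure is the intended distribution. -/
theorem MemR.measurable_gaugeSup {A : Set (Fin d → ℝ)} (hA : MemR A) :
    Measurable (gaugeSup A) := by
  have hcone : ∀ s : Set ℝ, MeasurableSet (⋃ u ∈ s, u • A) := by
    intro s
    have hopen : IsOpen (⋃ u ∈ s \ {0}, u • A) :=
      isOpen_biUnion fun u hu => hA.isOpen.smul₀ hu.2
    have heq : (⋃ u ∈ s, u • A) = (⋃ u ∈ s \ {0}, u • A) ∪ (⋃ u ∈ s ∩ {0}, u • A) := by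
      rw [← biUnion_union, sdiff_union_inter]
    rw [heq]
    refine hopen.measurableSet.union (Set.Subsingleton.measurableSet ?_)
    intro x hx y hy
    simp only [mem_iUnion, mem_inter_iff, mem_singleton_iff] at hx hy
    obtain ⟨u, ⟨-, rfl⟩, hx⟩ := hx
    obtain ⟨v, ⟨-, rfl⟩, hy⟩ := hy
    rw [zero_smul_set_subset A hx, zero_smul_set_subset A hy]
  refine measurable_of_Ioi fun t => ?_
  have key : gaugeSup A ⁻¹' Ioi t =
      (⋃ u ∈ Ioi t, u • A) ∪ ((⋃ u ∈ (univ : Set ℝ), u • A)ᶜ ∩ {_x | t < 0}) := by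
    ext x
    simp only [mem_preimage, mem_Ioi, mem_union, mem_iUnion, mem_inter_iff, mem_compl_iff,
      mem_univ, true_and, exists_prop, mem_ofPred_eq, not_exists]
    by_cases hne : {u : ℝ | x ∈ u • A}.Nonempty
    · have hlt : t < gaugeSup A x ↔ ∃ u, t < u ∧ x ∈ u • A := by
        rw [gaugeSup, lt_csSup_iff (hA.bddAbove x) hne]
        simp only [mem_ofPred_eq]
        exact exists_congr fun u => and_comm
      rw [hlt]
      obtain ⟨w, hw⟩ := hne
      constructor
      · exact Or.inl
      · rintro (h | ⟨h, -⟩)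
        · exact h
        · exact absurd hw (h w)
    · have hempty : ∀ u : ℝ, x ∉ u • A := fun u hu => hne ⟨u, hu⟩
      have h0 : gaugeSup A x = 0 := by
        rw [gaugeSup, not_nonempty_iff_eq_empty.1 hne, Real.sSup_empty]
      simp [h0, hempty]
  rw [key]
  exact (hcone _).union ((hcone _).compl.inter (MeasurableSet.const _))

/-- `F ∈ ℒ_A`. -/
def MemL (A : Set (Fin d → ℝ)) (F : Measure (Fin d → ℝ)) : Prop :=
  LongTailed (lawAlong A F)

/-- `F ∈ (𝒟 ∩ ℒ)_A`. -/
def MemDL (A : Set (Fin d → ℝ)) (F : Measure (Fin d → ℝ)) : Prop :=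
  DominatedlyVarying (lawAlong A F) ∧ LongTailed (lawAlong A F)

/-- `F ∈ 𝒞_A`. -/
def MemC (A : Set (Fin d → ℝ)) (F : Measure (Fin d → ℝ)) : Prop :=
  ConsistentlyVarying (lawAlong A F)

/-- `F ∈ 𝒮_A`. -/
def MemS (A : Set (Fin d → ℝ)) (F : Measure (Fin d → ℝ)) : Prop :=
  Subexponential (lawAlong A F)

/-- `Q((c x, ∞)) = o(H((x, ∞)))` as `x → ∞`, for every `c > 0`. -/
def NegligibleTail (Q H : Measure ℝ) : Prop :=
  ∀ c : ℝ, 0 < c → (fun x : ℝ => tail Q (c * x)) =o[atTop] (fun x : ℝ => tail H x)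

/-- Either `D` is empty, or it is not and the increments of the tail of `Q` at scale `t` are
negligible with respect to the tail of `H`, for each `t` in `D`. -/
def AtomCondition (D : Set ℝ) (Q H : Measure ℝ) : Prop :=
  D = ∅ ∨ (D.Nonempty ∧ ∀ t ∈ D,
    (fun x : ℝ => tail Q (x / t) - tail Q ((x + 1) / t)) =o[atTop] (fun x : ℝ => tail H x))

end HeavyTail

/-! The gauge `gaugeSup A` is positively homogeneous, so `M_A = Θ Y_A` and the law of `Θ X` along
`A` is `H = Measure.mconv Q V`, the law of a product of independent factors with laws `Q` and `V =
F_A`. Everything is then a statement about `H` on the half-line, proved by conditioning on the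
multiplier `θ`.

Long tails (`LongTailed.mconv`): `θ y ∈ (x, x + 1]` puts `y` in a window of length `1 / θ` at `x /
θ`. Small `θ` carry little mass; for `δ ≤ θ ≤ x / T` the long tail of `V` applies; for `θ > x / T`
the window is short and lies near `[0, T]`, so only the finitely many heavy atoms of `V` matter. At
an atom `t` the contribution is at most the increment of the tail of `Q` at scale `t`. Conversely,
such an atom forces this increment to be negligible once `H` is long-tailed.

Subexponentiality is long-tailedness together with negligibility of "sum exceeds `x`, both terms
exceed `K`". The second property passes from `V` to `H` for every probability measure `Q`
(`Subexponential.exists_jointExceed_mconv_le`), so only long-tailedness of `H` is at stake; this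
gives (II).

In (I), negligibility of the tail of `Q` implies the increment condition for any set of positive
atoms. Hence both sides of the last equivalence in (I) are true. -/

namespace HeavyTail

/-! ### Tails, long-tailedness through unit increments, and atoms. -/

section Tail

variable {V W : Measure ℝ}

lemma tail_nonneg (V : Measure ℝ) (x : ℝ) : 0 ≤ tail V x := measureReal_nonneg

lemma tail_anti (V : Measure ℝ) [IsFiniteMeasure V] {x y : ℝ} (h : x ≤ y) :
    tail V y ≤ tail V x :=
  measureReal_mono (Ioi_subset_Ioi h)

lemma tail_le_one (V : Measure ℝ) [IsProbabilityMeasure V] (x : ℝ) : tail V x ≤ 1 :=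
  measureReal_le_one

lemma ofReal_tail (V : Measure ℝ) [IsFiniteMeasure V] (x : ℝ) :
    ENNReal.ofReal (tail V x) = V (Ioi x) := ofReal_measureReal

lemma real_Ioc (V : Measure ℝ) [IsFiniteMeasure V] {x y : ℝ} (h : x ≤ y) :
    V.real (Ioc x y) = tail V x - tail V y := by
  have : V.real (Ioi x) = V.real (Ioc x y) + V.real (Ioi y) := by
    rw [← Ioc_union_Ioi_eq_Ioi h]
    exact measureReal_union (disjoint_left.2 fun z hz hz' => not_lt.2 hz.2 hz') measurableSet_Ioi
  unfold tail
  linarith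

lemma real_le_mul_iff {α β : Type*} [MeasurableSpace α] [MeasurableSpace β] {μ : Measure α}
    {ν : Measure β} [IsFiniteMeasure μ] [IsFiniteMeasure ν] {s : Set α} {t : Set β} {c : ℝ}
    (hc : 0 ≤ c) : μ.real s ≤ c * ν.real t ↔ μ s ≤ ENNReal.ofReal c * ν t := by
  rw [← ofReal_measureReal (μ := μ) (s := s), ← ofReal_measureReal (μ := ν) (s := t),
    ← ENNReal.ofReal_mul hc,
    ENNReal.ofReal_le_ofReal_iff (mul_nonneg hc measureReal_nonneg)]

lemma tendsto_measure_Ioi_atTop (V : Measure ℝ) [IsFiniteMeasure V] :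
    Tendsto (fun x : ℝ => V (Ioi x)) atTop (𝓝 0) := by
  have h := tendsto_measure_iInter_atTop (μ := V) (s := fun x : ℝ => Ioi x)
    (fun _ => measurableSet_Ioi.nullMeasurableSet) (fun _ _ h => Ioi_subset_Ioi h)
    ⟨0, measure_ne_top _ _⟩
  have he : ⋂ x : ℝ, Ioi x = ∅ :=
    eq_empty_of_forall_notMem fun y hy => lt_irrefl y (mem_iInter.1 hy y)
  rwa [he, measure_empty] at h

lemma tendsto_tail_atTop (V : Measure ℝ) [IsFiniteMeasure V] :
    Tendsto (tail V) atTop (𝓝 0) := by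
  have := (ENNReal.tendsto_toReal ENNReal.zero_ne_top).comp (tendsto_measure_Ioi_atTop V)
  exact this

lemma IsBase.measure_Ici (hV : IsBase V) : V (Ici 0) = 1 := by
  have := hV.isProbabilityMeasure
  have h := prob_compl_eq_one_sub (μ := V) (s := Iio 0) measurableSet_Iio
  rwa [compl_Iio, hV.support_nonneg, tsub_zero] at h

lemma IsBase.real_Ici (hV : IsBase V) : V.real (Ici 0) = 1 := by
  simp [measureReal_def, hV.measure_Ici]

lemma IsBase.real_Icc (hV : IsBase V) {x : ℝ} (hx : 0 ≤ x) :
    V.real (Icc 0 x) = 1 - tail V x := by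
  have := hV.isProbabilityMeasure
  have h : V.real (Ici 0) = V.real (Icc 0 x) + V.real (Ioi x) := by
    rw [← Icc_union_Ioi_eq_Ici hx]
    exact measureReal_union (disjoint_left.2 fun z hz hz' => not_lt.2 hz.2 hz') measurableSet_Ioi
  rw [hV.real_Ici] at h
  unfold tail
  linarith

lemma IsBase.ae_nonneg (hV : IsBase V) : ∀ᵐ y ∂V, 0 ≤ y := by
  rw [ae_iff]
  simpa [Iio_def] using hV.support_nonneg

lemma IsBase.measure_Ioi_pos (hV : IsBase V) {x : ℝ} (hx : 0 ≤ x) : 0 < V (Ioi x) := by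
  have := hV.isProbabilityMeasure
  rw [← ofReal_tail]
  exact ENNReal.ofReal_pos.2 (hV.tail_pos x hx)

/-- Unit shifts suffice: integer shifts follow by telescoping the ratio, all others by monotonicity
of the tail. -/
lemma IsBase.longTailed_of_isLittleO (hV : IsBase V)
    (h : (fun x => tail V x - tail V (x + 1)) =o[atTop] tail V) : LongTailed V := by
  have := hV.isProbabilityMeasure
  refine ⟨hV, ?_⟩
  have h1 : Tendsto (fun x : ℝ => tail V (x + 1) / tail V x) atTop (𝓝 1) := by
    have h2 := h.tendsto_div_nhds_zero.const_sub 1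
    rw [sub_zero] at h2
    refine h2.congr' ?_
    filter_upwards [eventually_ge_atTop 0] with x hx
    have := (hV.tail_pos x hx).ne'
    field_simp
    ring
  have h3 : Tendsto (fun x : ℝ => tail V (x - 1) / tail V x) atTop (𝓝 1) := by
    have h2 := (h1.comp (tendsto_atTop_add_const_right atTop (-1 : ℝ) tendsto_id)).inv₀ one_ne_zero
    rw [inv_one] at h2
    refine h2.congr fun x => ?_
    simp [sub_eq_add_neg]
  have hn : ∀ n : ℕ, Tendsto (fun x : ℝ => tail V (x - n) / tail V x) atTop (𝓝 1) := by
    intro n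
    induction n with
    | zero =>
      refine tendsto_const_nhds.congr' ?_
      filter_upwards [eventually_ge_atTop 0] with x hx
      simp [div_self (hV.tail_pos x hx).ne']
    | succ n ih =>
      have h4 := (h3.comp (tendsto_atTop_add_const_right atTop (-n : ℝ) tendsto_id)).mul ih
      rw [one_mul] at h4
      refine h4.congr' ?_
      filter_upwards [eventually_ge_atTop (n : ℝ)] with x hx
      have := (hV.tail_pos (x - n) (by linarith)).ne'
      simp only [Function.comp, id, Nat.cast_succ]
      rw [show x + -(n : ℝ) - 1 = x - (n + 1) by ring, show x + -(n : ℝ) = x - n by ring]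
      field_simp
  intro a ha
  obtain ⟨n, hna⟩ := exists_nat_ge a
  refine tendsto_of_tendsto_of_tendsto_of_le_of_le' tendsto_const_nhds (hn n) ?_ ?_
  · filter_upwards [eventually_ge_atTop 0] with x hx
    rw [le_div_iff₀ (hV.tail_pos x hx), one_mul]
    exact tail_anti V (by linarith)
  · filter_upwards [eventually_ge_atTop 0] with x hx
    exact div_le_div_of_nonneg_right (tail_anti V (by linarith)) (tail_nonneg _ _)

lemma LongTailed.isLittleO (hV : LongTailed V) {a : ℝ} (ha : 0 < a) :
    (fun x => tail V x - tail V (x + a)) =o[atTop] tail V := by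
  have h1 := (((hV.2 a ha).comp (tendsto_atTop_add_const_right atTop a tendsto_id)).inv₀
    one_ne_zero).const_sub 1
  rw [inv_one, sub_self] at h1
  refine isLittleO_of_tendsto' ?_ (h1.congr' ?_)
  · filter_upwards [eventually_ge_atTop 0] with x hx h0
    exact absurd h0 (hV.1.tail_pos x hx).ne'
  · filter_upwards [eventually_ge_atTop 0] with x hx
    have := (hV.1.tail_pos x hx).ne'
    simp only [Function.comp, id, add_sub_cancel_right, inv_div]
    field_simp

lemma isLittleO_tail_iff [IsFiniteMeasure W] {s : ℝ → Set ℝ} [IsFiniteMeasure V] :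
    (fun x => V.real (s x)) =o[atTop] tail W ↔
      ∀ ε : ℝ, 0 < ε → ∀ᶠ x in atTop, V (s x) ≤ ENNReal.ofReal ε * W (Ioi x) := by
  rw [isLittleO_iff]
  refine forall_congr' fun ε => ?_
  constructor <;> intro h hε <;> filter_upwards [h hε] with x hx
  · rwa [← real_le_mul_iff hε.le, ← Real.norm_of_nonneg (measureReal_nonneg (μ := V) (s := s x)),
      ← Real.norm_of_nonneg (measureReal_nonneg (μ := W) (s := Ioi x))]
  · rwa [← real_le_mul_iff hε.le, ← Real.norm_of_nonneg (measureReal_nonneg (μ := V) (s := s x)),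
      ← Real.norm_of_nonneg (measureReal_nonneg (μ := W) (s := Ioi x))] at hx

lemma LongTailed.eventually_measure_Ioc_le (hV : LongTailed V) {a ε : ℝ} (ha : 0 < a)
    (hε : 0 < ε) : ∀ᶠ x in atTop, V (Ioc x (x + a)) ≤ ENNReal.ofReal ε * V (Ioi x) := by
  have := hV.1.isProbabilityMeasure
  refine isLittleO_tail_iff.1 ((hV.isLittleO ha).congr_left fun x => ?_) ε hε
  rw [real_Ioc V (by linarith)]

/-- A finite measure on the line whose atoms are all lighter than `c` gives mass at most `c` to all
short enough intervals in a bounded region. -/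
lemma exists_measure_Ioc_le (V : Measure ℝ) [IsFiniteMeasure V] {c : ℝ≥0∞} (T : ℝ)
    (hc : ∀ t, V {t} < c) : ∃ η > 0, ∀ s ∈ Icc 0 T, V (Ioc s (s + η)) ≤ c := by
  have hball : ∀ t : ℝ, ∃ r > 0, V (Metric.closedBall t r) < c := by
    intro t
    have h := tendsto_measure_cthickening_of_isClosed (μ := V) (s := {t})
      ⟨1, one_pos, measure_ne_top _ _⟩ isClosed_singleton
    have h2 := (h.mono_left (nhdsWithin_le_nhds (s := Ioi 0))).eventually (gt_mem_nhds (hc t))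
    obtain ⟨r, hr, hr0⟩ := (h2.and self_mem_nhdsWithin).exists
    refine ⟨r, hr0, ?_⟩
    rwa [Metric.cthickening_singleton t (le_of_lt hr0)] at hr
  choose r hr0 hr using hball
  -- A Lebesgue number of the cover makes the window length uniform over the compact interval.
  obtain ⟨δ, hδ, h⟩ := lebesgue_number_lemma_of_metric (isCompact_Icc (a := (0 : ℝ)) (b := T))
    (c := fun t : ℝ => Metric.ball t (r t)) (fun _ => Metric.isOpen_ball)
    (fun t _ => mem_iUnion.2 ⟨t, Metric.mem_ball_self (hr0 t)⟩)
  refine ⟨δ / 2, half_pos hδ, fun s hs => ?_⟩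
  obtain ⟨t, ht⟩ := h s hs
  refine (measure_mono (Subset.trans ?_ (ht.trans Metric.ball_subset_closedBall))).trans (hr t).le
  intro y hy
  rw [Metric.mem_ball, Real.dist_eq, abs_lt]
  constructor <;> linarith [hy.1, hy.2]

lemma finite_setOf_le_measure_singleton (V : Measure ℝ) [IsFiniteMeasure V] {c : ℝ≥0∞}
    (hc : 0 < c) : {t : ℝ | c ≤ V {t}}.Finite :=
  Measure.finite_const_le_meas_of_disjoint_iUnion V hc (fun t => measurableSet_singleton t)
    (fun _ _ h => disjoint_singleton.2 h) (measure_ne_top _ _)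

end Tail

/-! ### Subexponentiality as long-tailedness plus negligible joint exceedance. -/

section Subexponential

variable {V W : Measure ℝ}

lemma measurableSet_sum_gt (x : ℝ) : MeasurableSet {p : ℝ × ℝ | x < p.1 + p.2} :=
  measurableSet_lt measurable_const (measurable_fst.add measurable_snd)

lemma tail_conv (V W : Measure ℝ) (x : ℝ) :
    tail (Measure.conv V W) x = (V.prod W).real {p | x < p.1 + p.2} := by
  unfold tail Measure.conv
  rw [map_measureReal_apply (by fun_prop) measurableSet_Ioi]
  rfl

/-- The event that the sum of two coordinates exceeds `x` although neither is at most `K`. -/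
def jointExceed (K x : ℝ) : Set (ℝ × ℝ) := {p | x < p.1 + p.2 ∧ K < p.1 ∧ K < p.2}

lemma measurableSet_jointExceed (K x : ℝ) : MeasurableSet (jointExceed K x) :=
  (measurableSet_sum_gt x).inter ((measurableSet_lt measurable_const measurable_fst).inter
    (measurableSet_lt measurable_const measurable_snd))

/-- Two strips where one coordinate is in `[0, K]` and the other exceeds `x` already account for
nearly `2 * tail V x` of the tail of the sum; little remains for the joint exceedance. -/
lemma Subexponential.exists_jointExceed_le (hV : Subexponential V) {ε : ℝ} (hε : 0 < ε) :
    ∃ K > 0, ∀ x, (V.prod V) (jointExceed K x) ≤ ENNReal.ofReal ε * V (Ioi x) := by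
  have hb := hV.1
  have := hb.isProbabilityMeasure
  have h1 := hV.2.eventually (gt_mem_nhds (show (2 : ℝ) < 2 + ε / 2 by linarith))
  have h2 := (tendsto_tail_atTop V).eventually (gt_mem_nhds (show (0 : ℝ) < ε / 4 by linarith))
  obtain ⟨x₀, hx₀⟩ := eventually_atTop.1 h1
  obtain ⟨K, hKpos, hKx, hK⟩ := ((eventually_gt_atTop 0).and
    ((eventually_ge_atTop x₀).and h2)).exists
  have main : ∀ x, 2 * K ≤ x → (V.prod V) (jointExceed K x) ≤ ENNReal.ofReal ε * V (Ioi x) := by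
    intro x hx
    rw [← real_le_mul_iff hε.le]
    have hpos := hb.tail_pos x (by linarith)
    have h3 := hx₀ x (by linarith)
    rw [div_lt_iff₀ hpos, tail_conv] at h3
    have hsub : jointExceed K x ∪ (Icc 0 K ×ˢ Ioi x ∪ Ioi x ×ˢ Icc 0 K) ⊆
        {p : ℝ × ℝ | x < p.1 + p.2} := by
      rintro p (hp | hp | hp)
      · exact hp.1
      · have := hp.1.1; have := hp.2; simp only [mem_Ioi, mem_ofPred_eq] at *; linarith
      · have := hp.2.1; have := hp.1; simp only [mem_Ioi, mem_ofPred_eq] at *; linarith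
    have h4 := (measureReal_mono hsub (measure_ne_top _ _)).trans h3.le
    rw [measureReal_union, measureReal_union, measureReal_prod_prod, measureReal_prod_prod,
      hb.real_Icc hKpos.le] at h4
    · change (V.prod V).real (jointExceed K x) ≤ ε * tail V x
      change _ + ((1 - tail V K) * tail V x + tail V x * (1 - tail V K)) ≤ _ at h4
      nlinarith
    · rw [disjoint_left]
      rintro p hp hp'
      have := hp.1.2; have := hp'.1
      simp only [mem_Ioi] at *
      linarith
    · exact measurableSet_Ioi.prod measurableSet_Icc
    · rw [disjoint_left]
      rintro p hp (hp' | hp')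
      · exact absurd hp'.1.2 (not_le.2 hp.2.1)
      · exact absurd hp'.2.2 (not_le.2 hp.2.2)
    · exact (measurableSet_Icc.prod measurableSet_Ioi).union
        (measurableSet_Ioi.prod measurableSet_Icc)
  refine ⟨K, hKpos, fun x => ?_⟩
  rcases le_total (2 * K) x with hx | hx
  · exact main x hx
  -- Two terms above `K` have sum above `2 * K`, so smaller `x` reduce to `x = 2 * K`.
  · have hsub : jointExceed K x ⊆ jointExceed K (2 * K) := fun p hp =>
      ⟨by have := hp.2.1; have := hp.2.2; linarith, hp.2⟩
    refine (measure_mono hsub).trans ((main _ le_rfl).trans ?_)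
    gcongr

lemma Subexponential.exists_sum_le (hV : Subexponential V) :
    ∃ C : ℝ, 0 < C ∧ ∀ x, 0 ≤ x →
      (V.prod V) {p | x < p.1 + p.2} ≤ ENNReal.ofReal C * V (Ioi x) := by
  have hb := hV.1
  have := hb.isProbabilityMeasure
  have h1 := hV.2.eventually (gt_mem_nhds (show (2 : ℝ) < 3 by norm_num))
  obtain ⟨x₀, hx₀, h⟩ := ((eventually_ge_atTop (0 : ℝ)).and (eventually_forall_ge_atTop.2 h1)).exists
  have hpos := hb.tail_pos x₀ hx₀
  refine ⟨3 + (tail V x₀)⁻¹, by positivity, fun x hx => ?_⟩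
  rw [← real_le_mul_iff (by positivity)]
  change _ ≤ _ * tail V x
  rcases le_total x₀ x with hxx | hxx
  · have h2 := h x hxx
    rw [div_lt_iff₀ (hb.tail_pos x hx), tail_conv] at h2
    have := mul_nonneg (inv_nonneg.2 hpos.le) (tail_nonneg V x)
    linarith
  · refine measureReal_le_one.trans ?_
    have h3 : 1 ≤ (tail V x₀)⁻¹ * tail V x := by
      rw [inv_mul_eq_div, le_div_iff₀ hpos, one_mul]
      exact tail_anti V hxx
    linarith [tail_nonneg V x]

/-- Splitting the first summand at `a` and `x` bounds the tail of the sum below by `(1 - tail V a) *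
tail V x + (tail V a - tail V x) * tail V (x - a) + tail V x`. Solving for the ratio gives an upper
bound tending to `1`. -/
lemma Subexponential.longTailed (hV : Subexponential V) : LongTailed V := by
  have hb := hV.1
  have := hb.isProbabilityMeasure
  refine ⟨hb, fun a ha => ?_⟩
  have hva := hb.tail_pos a ha.le
  have hub : Tendsto (fun x => (tail (Measure.conv V V) x / tail V x - 2 + tail V a) /
      (tail V a - tail V x)) atTop (𝓝 1) := by
    have := ((hV.2.sub_const 2).add_const (tail V a)).div
      ((tendsto_tail_atTop V).const_sub (tail V a)) (by simpa using hva.ne')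
    rw [sub_self, zero_add, sub_zero, div_self hva.ne'] at this
    exact this
  refine tendsto_of_tendsto_of_tendsto_of_le_of_le' tendsto_const_nhds hub ?_ ?_
  · filter_upwards [eventually_ge_atTop 0] with x hx
    rw [le_div_iff₀ (hb.tail_pos x hx), one_mul]
    exact tail_anti V (by linarith)
  · filter_upwards [eventually_ge_atTop a,
      (tendsto_tail_atTop V).eventually (gt_mem_nhds hva)] with x hx hxa
    have hpos := hb.tail_pos x (by linarith)
    rw [le_div_iff₀ (by linarith)]
    have hsub : Icc 0 a ×ˢ Ioi x ∪ (Ioc a x ×ˢ Ioi (x - a) ∪ Ioi x ×ˢ Ici 0) ⊆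
        {p : ℝ × ℝ | x < p.1 + p.2} := by
      rintro p (⟨hp, hp'⟩ | ⟨hp, hp'⟩ | ⟨hp, hp'⟩) <;>
        simp only [mem_Ioi, mem_Icc, mem_Ioc, mem_Ici, mem_ofPred_eq] at * <;> linarith
    have h4 := measureReal_mono (μ := V.prod V) hsub (measure_ne_top _ _)
    rw [measureReal_union, measureReal_union, measureReal_prod_prod, measureReal_prod_prod,
      measureReal_prod_prod, hb.real_Icc ha.le, real_Ioc V hx, hb.real_Ici, ← tail_conv] at h4
    · change (1 - tail V a) * tail V x + ((tail V a - tail V x) * tail V (x - a) +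
        tail V x * 1) ≤ _ at h4
      rw [div_mul_eq_mul_div, div_le_iff₀ hpos, add_mul, sub_mul, div_mul_cancel₀ _ hpos.ne']
      linarith
    · rw [disjoint_left]
      rintro p ⟨hp, -⟩ ⟨hp', -⟩
      exact not_lt.2 hp.2 hp'
    · exact measurableSet_Ioi.prod measurableSet_Ici
    · rw [disjoint_left]
      rintro p ⟨hp, -⟩ (⟨hp', -⟩ | ⟨hp', -⟩)
      · exact not_lt.2 hp.2 hp'.1
      · exact not_lt.2 (hp.2.trans hx) hp'
    · exact (measurableSet_Ioc.prod measurableSet_Ioi).union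
        (measurableSet_Ioi.prod measurableSet_Ici)

lemma LongTailed.subexponential (hV : LongTailed V)
    (h : ∀ ε : ℝ, 0 < ε → ∃ K > 0, ∀ᶠ x in atTop,
      (V.prod V) (jointExceed K x) ≤ ENNReal.ofReal ε * V (Ioi x)) : Subexponential V := by
  have hb := hV.1
  have := hb.isProbabilityMeasure
  refine ⟨hb, tendsto_order.2 ⟨fun c hc => ?_, fun c hc => ?_⟩⟩
  · filter_upwards [eventually_ge_atTop 0, (tendsto_tail_atTop V).eventually
      (gt_mem_nhds (show (0 : ℝ) < 2 - c by linarith))] with x hx hxc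
    have hpos := hb.tail_pos x hx
    rw [lt_div_iff₀ hpos, tail_conv]
    have hsub : Icc 0 x ×ˢ Ioi x ∪ Ioi x ×ˢ Ici 0 ⊆ {p : ℝ × ℝ | x < p.1 + p.2} := by
      rintro p (⟨hp, hp'⟩ | ⟨hp, hp'⟩) <;>
        simp only [mem_Ioi, mem_Icc, mem_Ici, mem_ofPred_eq] at * <;> linarith
    have h4 := measureReal_mono (μ := V.prod V) hsub (measure_ne_top _ _)
    rw [measureReal_union, measureReal_prod_prod, measureReal_prod_prod, hb.real_Icc hx,
      hb.real_Ici] at h4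
    · change (1 - tail V x) * tail V x + tail V x * 1 ≤ _ at h4
      nlinarith
    · rw [disjoint_left]
      rintro p ⟨hp, -⟩ ⟨hp', -⟩
      exact not_lt.2 hp.2 hp'
    · exact measurableSet_Ioi.prod measurableSet_Ici
  · have hε : 0 < (c - 2) / 4 := by linarith
    -- With `ε = (c - 2) / 4` the joint part and the two strips at level `x - K` total at most `2 +
    -- 3 * ε < c`.
    obtain ⟨K, hK0, hK⟩ := h _ hε
    filter_upwards [eventually_ge_atTop 0, hK, (hV.2 K hK0).eventually
      (gt_mem_nhds (show (1 : ℝ) < 1 + (c - 2) / 4 by linarith))] with x hx h1 h2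
    have hpos := hb.tail_pos x hx
    rw [div_lt_iff₀ hpos] at h2 ⊢
    rw [← real_le_mul_iff hε.le] at h1
    rw [tail_conv]
    have hsub : {p : ℝ × ℝ | x < p.1 + p.2} ⊆
        jointExceed K x ∪ (univ ×ˢ Ioi (x - K) ∪ Ioi (x - K) ×ˢ univ) := by
      intro p hp
      simp only [mem_ofPred_eq] at hp
      by_cases h1 : K < p.1
      · by_cases h2 : K < p.2
        · exact Or.inl ⟨hp, h1, h2⟩
        · exact Or.inr (Or.inr ⟨show x - K < p.1 by linarith, mem_univ _⟩)
      · exact Or.inr (Or.inl ⟨mem_univ _, show x - K < p.2 by linarith⟩)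
    have h4 := measureReal_mono (μ := V.prod V) hsub (measure_ne_top _ _)
    have h5 := h4.trans ((measureReal_union_le _ _).trans
      (add_le_add_right (measureReal_union_le _ _) _))
    rw [measureReal_prod_prod, measureReal_prod_prod, probReal_univ] at h5
    change _ ≤ (V.prod V).real (jointExceed K x) + (1 * tail V (x - K) + tail V (x - K) * 1) at h5
    change (V.prod V).real (jointExceed K x) ≤ (c - 2) / 4 * tail V x at h1
    nlinarith

end Subexponential

/-! ### Products of independent factors and long tails. -/

section Product

variable {Q V : Measure ℝ}

instance [IsProbabilityMeasure Q] [IsProbabilityMeasure V] :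
    IsProbabilityMeasure (Measure.mconv Q V) :=
  Measure.isProbabilityMeasure_map (by fun_prop)

lemma mconv_apply_eq_lintegral [SFinite V] {s : Set ℝ} (hs : MeasurableSet s) :
    Measure.mconv Q V s = ∫⁻ θ, V {y | θ * y ∈ s} ∂Q := by
  have hm : Measurable fun p : ℝ × ℝ => p.1 * p.2 := by fun_prop
  rw [Measure.mconv, Measure.map_apply hm hs, Measure.prod_apply (hm hs)]
  rfl

lemma measurable_measure_setOf_mul_mem [SFinite V] {s : Set ℝ} (hs : MeasurableSet s) :
    Measurable fun θ : ℝ => V {y | θ * y ∈ s} :=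
  measurable_measure_prodMk_left (ν := V) (s := (fun p : ℝ × ℝ => p.1 * p.2) ⁻¹' s)
    ((measurable_fst.mul measurable_snd) hs)

lemma mul_le_mconv [SFinite Q] [SFinite V] {S R s : Set ℝ} (hs : MeasurableSet s)
    (h : ∀ θ ∈ S, ∀ y ∈ R, θ * y ∈ s) : Q S * V R ≤ Measure.mconv Q V s := by
  have hm : Measurable fun p : ℝ × ℝ => p.1 * p.2 := by fun_prop
  rw [Measure.mconv, Measure.map_apply hm hs, ← Measure.prod_prod]
  exact measure_mono fun p hp => h _ hp.1 _ hp.2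

lemma setOf_mul_mem_Ioi {θ : ℝ} (hθ : 0 < θ) (x : ℝ) : {y | θ * y ∈ Ioi x} = Ioi (x / θ) := by
  ext y
  simp [div_lt_iff₀ hθ, mul_comm]

lemma IsBase.measure_setOf_mul_mem_eq_zero (hV : IsBase V) {θ : ℝ} (hθ : θ ≤ 0) {s : Set ℝ}
    (hs : s ⊆ Ioi 0) : V {y | θ * y ∈ s} = 0 := by
  refine measure_mono_null (fun y hy => ?_) hV.support_nonneg
  have h1 : 0 < θ * y := hs hy
  by_contra h
  exact absurd h1 (not_lt.2 (mul_nonpos_of_nonpos_of_nonneg hθ (not_lt.1 h)))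

lemma exists_measure_Ioo_le [IsFiniteMeasure Q] (hQ : 0 < Q (Ioi 0)) {ε : ℝ} (hε : 0 < ε) :
    ∃ δ > 0, Q (Ioo 0 δ) ≤ ENNReal.ofReal ε * Q (Ici δ) ∧ 0 < Q (Ici δ) := by
  have h := tendsto_measure_biInter_gt (μ := Q) (s := fun r : ℝ => Ioo 0 r) (a := 0)
    (fun _ _ => measurableSet_Ioo.nullMeasurableSet) (fun _ _ _ h => Ioo_subset_Ioo_right h)
    ⟨1, one_pos, measure_ne_top _ _⟩
  have he : ⋂ r > (0 : ℝ), Ioo 0 r = ∅ := by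
    refine eq_empty_of_forall_notMem fun y hy => ?_
    have h1 := mem_iInter₂.1 hy 1 one_pos
    exact lt_irrefl y (mem_iInter₂.1 hy y h1.1).2
  rw [he, measure_empty] at h
  have h2 := (ENNReal.tendsto_toReal ENNReal.zero_ne_top).comp h
  set q := Q.real (Ioi 0) with hq
  have hq0 : 0 < q := ENNReal.toReal_pos hQ.ne' (measure_ne_top _ _)
  -- The first bound leaves more than `q / 2` on `[δ, ∞)`; the second then yields the factor `ε`.
  have hc : (0 : ℝ) < min (q / 2) (ε * (q / 2)) := by positivity
  obtain ⟨δ, hδ, hδ0⟩ := ((h2.eventually (gt_mem_nhds hc)).and self_mem_nhdsWithin).exists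
  have hδ' : Q.real (Ioo 0 δ) < min (q / 2) (ε * (q / 2)) := hδ
  obtain ⟨h3, h4⟩ := lt_min_iff.1 hδ'
  have h5 : q = Q.real (Ioo 0 δ) + Q.real (Ici δ) := by
    rw [hq, ← Ioo_union_Ici_eq_Ioi hδ0]
    exact measureReal_union (disjoint_left.2 fun z hz hz' => not_lt.2 hz' hz.2) measurableSet_Ici
  have h6 : q / 2 < Q.real (Ici δ) := by linarith
  refine ⟨δ, hδ0, ?_, ?_⟩
  · rw [← real_le_mul_iff hε.le]
    nlinarith
  · exact (ENNReal.toReal_pos_iff.1 ((half_pos hq0).trans h6)).1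

lemma IsBase.mconv [IsProbabilityMeasure Q] (hV : IsBase V) (hQ0 : Q (Iio 0) = 0)
    (hQ : 0 < Q (Ioi 0)) : IsBase (Measure.mconv Q V) := by
  have := hV.isProbabilityMeasure
  refine ⟨inferInstance, ?_, fun x hx => ?_⟩
  · rw [mconv_apply_eq_lintegral measurableSet_Iio, lintegral_eq_zero_iff
      (measurable_measure_setOf_mul_mem measurableSet_Iio)]
    have : ∀ᵐ θ ∂Q, 0 ≤ θ := by
      rw [ae_iff]
      simpa [Iio_def] using hQ0
    filter_upwards [this] with θ hθ
    refine measure_mono_null (fun y hy => ?_) hV.support_nonneg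
    have h1 : θ * y < 0 := hy
    by_contra h
    exact absurd h1 (not_lt.2 (mul_nonneg hθ (not_lt.1 h)))
  · obtain ⟨δ, hδ, -, h⟩ := exists_measure_Ioo_le hQ one_pos
    have h1 : Q (Ici δ) * V (Ioi (x / δ)) ≤ Measure.mconv Q V (Ioi x) := by
      refine mul_le_mconv measurableSet_Ioi fun θ hθ y hy => ?_
      have hy' : x < y * δ := (div_lt_iff₀ hδ).1 hy
      have hy0 : 0 < y := lt_of_le_of_lt (div_nonneg hx hδ.le) hy
      have : y * δ ≤ y * θ := mul_le_mul_of_nonneg_left hθ hy0.le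
      rw [mem_Ioi]
      linarith
    refine ENNReal.toReal_pos (lt_of_lt_of_le ?_ h1).ne' (measure_ne_top _ _)
    exact ENNReal.mul_pos h.ne' (hV.measure_Ioi_pos (div_nonneg hx hδ.le)).ne'

/-- If the product is long-tailed, the increments of the tail of the multiplier are negligible at
the scale of each atom of the other factor. -/
lemma LongTailed.isLittleO_of_mconv [IsProbabilityMeasure Q] [IsProbabilityMeasure V]
    (hH : LongTailed (Measure.mconv Q V)) {t : ℝ} (ht : t ∈ posAtoms V) :
    (fun x => tail Q (x / t) - tail Q ((x + 1) / t)) =o[atTop] tail (Measure.mconv Q V) := by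
  obtain ⟨ht0, htV⟩ := ht
  have hv : 0 < V.real {t} := ENNReal.toReal_pos htV.ne' (measure_ne_top _ _)
  refine IsBigO.trans_isLittleO ?_ (hH.isLittleO one_pos)
  refine IsBigO.of_bound (V.real {t})⁻¹ (Eventually.of_forall fun x => ?_)
  have hxt : x / t ≤ (x + 1) / t := by gcongr; linarith
  rw [← real_Ioc Q hxt, ← real_Ioc _ (show x ≤ x + 1 by linarith),
    Real.norm_of_nonneg measureReal_nonneg, Real.norm_of_nonneg measureReal_nonneg,
    inv_mul_eq_div, le_div_iff₀ hv, measureReal_def, measureReal_def, measureReal_def,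
    ← ENNReal.toReal_mul]
  -- The multiplier in `(x / t, (x + 1) / t]` and the other factor equal to `t` put the product in
  -- `(x, x + 1]`.
  refine ENNReal.toReal_mono (measure_ne_top _ _) (mul_le_mconv measurableSet_Ioc ?_)
  rintro θ hθ y rfl
  exact ⟨(div_lt_iff₀ ht0).1 hθ.1, (le_div_iff₀ ht0).1 hθ.2⟩

/-- The bound before integration in `θ`, by the ranges `θ < δ`, `δ ≤ θ ≤ x / T` and `θ > x / T`. In
the last range the window starts in `[0, T]` and has length at most `T / x ≤ η`; `D` collects the
atoms to be treated separately. -/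
lemma measure_setOf_mul_mem_Ioc_le (hV : IsBase V) {e : ℝ≥0∞} {δ T η x : ℝ} {D : Finset ℝ}
    (hδ : 0 < δ) (hT : 0 < T) (hx : 0 < x) (hxη : T / x ≤ η)
    (h1 : ∀ s, T ≤ s → V (Ioc s (s + 1 / δ)) ≤ e * V (Ioi s))
    (h2 : ∀ s ∈ Icc 0 T, V (Ioc s (s + η) ∩ (D : Set ℝ)ᶜ) ≤ e * V (Ioi T)) (θ : ℝ) :
    V {y | θ * y ∈ Ioc x (x + 1)} ≤ (Ioo 0 δ).indicator (fun _ => V (Ioi (x / δ))) θ +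
      e * V {y | θ * y ∈ Ioi x} + (Ioi (x / T)).indicator (fun _ => e * V (Ioi T)) θ +
      ∑ t ∈ D, {θ | θ * t ∈ Ioc x (x + 1)}.indicator (fun _ => 1) θ := by
  have := hV.isProbabilityMeasure
  rcases le_or_gt θ 0 with hθ | hθ
  · rw [hV.measure_setOf_mul_mem_eq_zero hθ (fun z hz => lt_trans hx hz.1)]
    exact zero_le
  have hset : {y | θ * y ∈ Ioc x (x + 1)} = Ioc (x / θ) ((x + 1) / θ) := by
    ext y
    simp [div_lt_iff₀ hθ, le_div_iff₀ hθ, mul_comm]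
  have hdiv : (x + 1) / θ = x / θ + 1 / θ := add_div _ _ _
  have hs0 : 0 < x / θ := div_pos hx hθ
  rcases lt_or_ge θ δ with hθδ | hθδ
  · rw [indicator_of_mem (show θ ∈ Ioo 0 δ from ⟨hθ, hθδ⟩), add_assoc, add_assoc]
    refine le_add_right (measure_mono ?_)
    rw [hset]
    intro y hy
    exact lt_of_le_of_lt (div_le_div_of_nonneg_left hx.le hθ hθδ.le) hy.1
  rcases le_or_gt θ (x / T) with hθT | hθT
  · have hTs : T ≤ x / θ := (le_div_iff₀ hθ).2 (by rwa [le_div_iff₀ hT, mul_comm] at hθT)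
    rw [add_assoc, add_assoc]
    refine le_add_left (le_add_right ?_)
    rw [setOf_mul_mem_Ioi hθ, hset, hdiv]
    refine (measure_mono (Ioc_subset_Ioc_right ?_)).trans (h1 _ hTs)
    gcongr
  · rw [indicator_of_mem (show θ ∈ Ioi (x / T) from hθT), add_assoc]
    refine le_add_left ?_
    have hsT : x / θ ≤ T := (div_le_iff₀ hθ).2 (by
      rw [div_lt_iff₀ hT] at hθT; linarith)
    have hη : 1 / θ ≤ η := by
      refine le_trans ?_ hxη
      rw [div_le_div_iff₀ hθ hx]
      rw [div_le_iff₀ hθ] at hsT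
      linarith
    set E := {y | θ * y ∈ Ioc x (x + 1)} with hE
    have hcov : E ⊆ (Ioc (x / θ) (x / θ + η) ∩ (D : Set ℝ)ᶜ) ∪ ⋃ t ∈ D, E ∩ {t} := by
      intro y hy
      by_cases hyD : y ∈ D
      · exact Or.inr (mem_iUnion₂.2 ⟨y, hyD, hy, rfl⟩)
      · refine Or.inl ⟨?_, hyD⟩
        rw [hset, hdiv] at hy
        exact ⟨hy.1, hy.2.trans (by linarith)⟩
    refine (measure_mono hcov).trans ((measure_union_le _ _).trans
      (add_le_add (h2 _ ⟨hs0.le, hsT⟩) ((measure_biUnion_finset_le _ _).trans ?_)))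
    refine Finset.sum_le_sum fun t _ => ?_
    by_cases ht : t ∈ E
    · rw [indicator_of_mem (show θ ∈ {θ | θ * t ∈ Ioc x (x + 1)} from ht)]
      exact prob_le_one
    · rw [inter_singleton_eq_empty.2 ht, measure_empty]
      exact zero_le

/-- The product with a long-tailed factor is long-tailed as soon as the increments of the tail of
the multiplier are negligible at the scale of each positive atom of that factor. -/
lemma LongTailed.mconv [IsProbabilityMeasure Q] (hV : LongTailed V) (hQ0 : Q (Iio 0) = 0)
    (hQ : 0 < Q (Ioi 0)) (hD : ∀ t ∈ posAtoms V,
      (fun x => tail Q (x / t) - tail Q ((x + 1) / t)) =o[atTop] tail (Measure.mconv Q V)) :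
    LongTailed (Measure.mconv Q V) := by
  have hb := hV.1
  have := hb.isProbabilityMeasure
  refine (hb.mconv hQ0 hQ).longTailed_of_isLittleO ?_
  suffices h : ∀ ε : ℝ, 0 < ε → ∀ᶠ x in atTop,
      Measure.mconv Q V (Ioc x (x + 1)) ≤ ENNReal.ofReal ε * Measure.mconv Q V (Ioi x) from
    (isLittleO_tail_iff.2 h).congr_left fun x => real_Ioc _ (by linarith)
  intro ε' hε'
  obtain ⟨ε, hε, rfl⟩ : ∃ ε > 0, 4 * ε = ε' := ⟨ε' / 4, by positivity, by ring⟩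
  set e := ENNReal.ofReal ε with he
  have he0 : 0 < e := ENNReal.ofReal_pos.2 hε
  obtain ⟨δ, hδ, hδQ, -⟩ := exists_measure_Ioo_le hQ hε
  obtain ⟨T, hT, h1⟩ := ((eventually_gt_atTop (0 : ℝ)).and (eventually_forall_ge_atTop.2
    (hV.eventually_measure_Ioc_le (one_div_pos.2 hδ) hε))).exists
  -- Atoms count as heavy from this threshold on, so that what is left, weighted by `Q (Ioi (x /
  -- T))`, is at most `e` times the tail of the product.
  have hc : 0 < e * V (Ioi T) := ENNReal.mul_pos he0.ne' (hb.measure_Ioi_pos hT.le).ne'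
  have hfin := finite_setOf_le_measure_singleton V hc
  set D := hfin.toFinset with hDdef
  obtain ⟨η, hη, h2⟩ := exists_measure_Ioc_le (V.restrict (D : Set ℝ)ᶜ) (c := e * V (Ioi T)) T (by
    intro t
    rw [Measure.restrict_apply (measurableSet_singleton t)]
    by_cases ht : t ∈ D
    · rwa [singleton_inter_eq_empty.2 (by simpa using ht), measure_empty]
    · refine (measure_mono inter_subset_left).trans_lt ?_
      simpa [hDdef] using ht)
  have hatoms : ∀ᶠ x in atTop, ∑ t ∈ D, Q {θ | θ * t ∈ Ioc x (x + 1)} ≤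
      e * Measure.mconv Q V (Ioi x) := by
    have ho : ∀ t ∈ D, (fun x => Q.real {θ | θ * t ∈ Ioc x (x + 1)}) =o[atTop]
        tail (Measure.mconv Q V) := by
      intro t ht
      have htV : 0 < V {t} := hc.trans_le (by simpa [hDdef] using ht)
      rcases lt_or_ge 0 t with ht0 | ht0
      · refine (hD t ⟨ht0, htV⟩).congr_left fun x => ?_
        rw [← real_Ioc Q (by gcongr; linarith)]
        congr 1
        ext θ
        simp [div_lt_iff₀ ht0, le_div_iff₀ ht0]
      -- A nonpositive heavy atom, possibly `0`, would need a negative multiplier to reach a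
      -- positive level.
      · refine (isLittleO_zero _ _).congr' ?_ EventuallyEq.rfl
        filter_upwards [eventually_gt_atTop 0] with x hx
        rw [measureReal_def, measure_mono_null (fun θ hθ => ?_) hQ0, ENNReal.toReal_zero]
        have : 0 < θ * t := lt_trans hx hθ.1
        by_contra h
        exact absurd this (not_lt.2 (mul_nonpos_of_nonneg_of_nonpos (not_lt.1 h) ht0))
    filter_upwards [(isLittleO_iff.1 (IsLittleO.sum ho)) hε] with x hx
    rw [Finset.sum_apply, Real.norm_of_nonneg (Finset.sum_nonneg fun _ _ => measureReal_nonneg),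
      Real.norm_of_nonneg (tail_nonneg _ _)] at hx
    have := ENNReal.ofReal_le_ofReal hx
    rw [ENNReal.ofReal_mul hε.le, ofReal_tail,
      ENNReal.ofReal_sum_of_nonneg fun _ _ => measureReal_nonneg] at this
    exact (Finset.sum_congr rfl fun t _ => (ofReal_measureReal (μ := Q)).symm).trans_le this
  filter_upwards [eventually_gt_atTop 0, eventually_ge_atTop (T / η), hatoms] with x hx hxη hxD
  have hbound := measure_setOf_mul_mem_Ioc_le hb (e := e) (η := η) (D := D) hδ hT hx
    ((div_le_comm₀ hη hx).1 hxη) h1 (fun s hs => by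
      have := h2 s hs
      rwa [Measure.restrict_apply measurableSet_Ioc] at this)
  have hmeas : ∀ t : ℝ, MeasurableSet {θ : ℝ | θ * t ∈ Ioc x (x + 1)} := fun t =>
    (measurable_id.mul_const t) measurableSet_Ioc
  have hg := measurable_measure_setOf_mul_mem (V := V) (measurableSet_Ioi (a := x))
  rw [mconv_apply_eq_lintegral measurableSet_Ioc]
  refine (lintegral_mono hbound).trans ?_
  rw [lintegral_add_right _ (Finset.measurable_sum _ fun t _ =>
      measurable_const.indicator (hmeas t)),
    lintegral_add_right _ (measurable_const.indicator measurableSet_Ioi),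
    lintegral_add_right _ (hg.const_mul _), lintegral_indicator_const measurableSet_Ioo,
    lintegral_indicator_const measurableSet_Ioi, lintegral_const_mul _ hg,
    ← mconv_apply_eq_lintegral measurableSet_Ioi, lintegral_finsetSum _ fun t _ =>
      measurable_const.indicator (hmeas t)]
  simp only [lintegral_indicator_const (hmeas _), one_mul]
  have hA : V (Ioi (x / δ)) * Q (Ioo 0 δ) ≤ e * Measure.mconv Q V (Ioi x) := by
    calc V (Ioi (x / δ)) * Q (Ioo 0 δ) ≤ V (Ioi (x / δ)) * (e * Q (Ici δ)) := by gcongr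
      _ = e * (Q (Ici δ) * V (Ioi (x / δ))) := by ring
      _ ≤ e * Measure.mconv Q V (Ioi x) := by
        gcongr
        refine mul_le_mconv measurableSet_Ioi fun θ hθ y hy => ?_
        have hy0 : 0 < y := lt_trans (div_pos hx hδ) hy
        rw [mem_Ioi, div_lt_iff₀ hδ] at hy
        rw [mem_Ioi]
        nlinarith [mem_Ici.1 hθ]
  have hB : e * V (Ioi T) * Q (Ioi (x / T)) ≤ e * Measure.mconv Q V (Ioi x) := by
    rw [mul_assoc, mul_comm (V _)]
    gcongr
    refine mul_le_mconv measurableSet_Ioi fun θ hθ y hy => ?_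
    have hθ0 : 0 < θ := lt_trans (div_pos hx hT) hθ
    rw [mem_Ioi, div_lt_iff₀ hT] at hθ
    rw [mem_Ioi] at hy ⊢
    nlinarith
  calc _ ≤ e * Measure.mconv Q V (Ioi x) + e * Measure.mconv Q V (Ioi x) +
        e * Measure.mconv Q V (Ioi x) + e * Measure.mconv Q V (Ioi x) := by gcongr
    _ = ENNReal.ofReal (4 * ε) * Measure.mconv Q V (Ioi x) := by
      rw [ENNReal.ofReal_mul (by norm_num), ← he]
      norm_num
      ring

end Product

/-! ### Dominated and consistent variation of products. -/

section DominatedConsistent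

variable {Q V : Measure ℝ}

/-- The bound must hold for all `s ≥ 0`, since `s = x / θ` is unrestricted after conditioning. Below
`s₀` the summand `(tail V s₀)⁻¹` in the constant suffices. -/
lemma DominatedlyVarying.exists_le (hV : DominatedlyVarying V) {b : ℝ} (hb0 : 0 < b)
    (hb1 : b < 1) : ∃ C : ℝ, 0 ≤ C ∧ ∀ s, 0 ≤ s →
      V (Ioi (b * s)) ≤ ENNReal.ofReal C * V (Ioi s) := by
  have hb := hV.1
  have := hb.isProbabilityMeasure
  obtain ⟨c, hc, -⟩ := ENNReal.lt_iff_exists_nnreal_btwn.1 (hV.2 b hb0 hb1)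
  obtain ⟨s₀, hs₀, h⟩ := ((eventually_ge_atTop (0 : ℝ)).and
    (eventually_forall_ge_atTop.2 (eventually_lt_of_limsup_lt hc))).exists
  have hpos := hb.tail_pos s₀ hs₀
  refine ⟨c + (tail V s₀)⁻¹, by positivity, fun s hs => ?_⟩
  rw [← real_le_mul_iff (by positivity)]
  change tail V (b * s) ≤ _ * tail V s
  have hs' := tail_nonneg V s
  rcases le_total s₀ s with hss | hss
  · have h1 := h s hss
    rw [← ENNReal.ofReal_coe_nnreal, ENNReal.ofReal_lt_ofReal_iff_of_nonneg
      (div_nonneg (tail_nonneg _ _) hs'), div_lt_iff₀ (hb.tail_pos s hs)] at h1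
    have := mul_nonneg (inv_nonneg.2 hpos.le) hs'
    linarith
  · refine (tail_le_one V _).trans ?_
    have h3 : 1 ≤ (tail V s₀)⁻¹ * tail V s := by
      rw [inv_mul_eq_div, le_div_iff₀ hpos, one_mul]
      exact tail_anti V hss
    have := mul_nonneg c.coe_nonneg hs'
    linarith

lemma DominatedlyVarying.mconv [IsProbabilityMeasure Q] (hV : DominatedlyVarying V)
    (hQ0 : Q (Iio 0) = 0) (hQ : 0 < Q (Ioi 0)) : DominatedlyVarying (Measure.mconv Q V) := by
  have hb := hV.1
  have := hb.isProbabilityMeasure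
  have hH := hb.mconv hQ0 hQ
  refine ⟨hH, fun b hb0 hb1 => ?_⟩
  obtain ⟨C, hC, h⟩ := hV.exists_le hb0 hb1
  refine lt_of_le_of_lt (b := ENNReal.ofReal C) ?_ ENNReal.ofReal_lt_top
  refine limsup_le_of_le (h := ?_)
  filter_upwards [eventually_gt_atTop 0] with x hx
  refine ENNReal.ofReal_le_ofReal ?_
  rw [div_le_iff₀ (hH.tail_pos x hx.le)]
  refine (real_le_mul_iff hC).2 ?_
  rw [mconv_apply_eq_lintegral measurableSet_Ioi, mconv_apply_eq_lintegral measurableSet_Ioi,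
    ← lintegral_const_mul _ (measurable_measure_setOf_mul_mem measurableSet_Ioi)]
  refine lintegral_mono fun θ => ?_
  rcases le_or_gt θ 0 with hθ | hθ
  · rw [hb.measure_setOf_mul_mem_eq_zero hθ (Ioi_subset_Ioi (mul_pos hb0 hx).le)]
    exact zero_le
  · simp only [setOf_mul_mem_Ioi hθ]
    rw [mul_div_assoc]
    exact h _ (div_pos hx hθ).le

/-- Only the upper half of the limit carries content: for `b < 1` the tail ratio is at least `1` as
soon as `x ≥ 0`. -/
lemma consistentlyVarying_iff : ConsistentlyVarying V ↔ IsBase V ∧ ∀ ε : ℝ, 0 < ε →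
    ∀ᶠ b in 𝓝[<] (1 : ℝ), ∀ᶠ x in atTop, V (Ioi (b * x)) ≤ ENNReal.ofReal (1 + ε) * V (Ioi x) := by
  refine and_congr_right fun hb => ?_
  have := hb.isProbabilityMeasure
  constructor
  · intro h ε hε
    have h1 := h.eventually (gt_mem_nhds (show (1 : ℝ≥0∞) < ENNReal.ofReal (1 + ε) by
      rw [ENNReal.one_lt_ofReal]; linarith))
    filter_upwards [h1] with b hb1
    filter_upwards [eventually_lt_of_limsup_lt hb1, eventually_ge_atTop 0] with x hx hx0
    rw [ENNReal.ofReal_lt_ofReal_iff_of_nonneg (div_nonneg (tail_nonneg _ _) (tail_nonneg _ _)),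
      div_lt_iff₀ (hb.tail_pos x hx0)] at hx
    exact (real_le_mul_iff (by positivity)).1 hx.le
  · intro h
    refine tendsto_order.2 ⟨fun c hc => ?_, fun c hc => ?_⟩
    · filter_upwards [self_mem_nhdsWithin] with b hb1
      refine hc.trans_le (le_limsup_of_frequently_le (Eventually.frequently ?_))
      filter_upwards [eventually_ge_atTop 0] with x hx
      rw [ENNReal.one_le_ofReal, le_div_iff₀ (hb.tail_pos x hx), one_mul]
      exact tail_anti V (by nlinarith [mem_Iio.1 hb1])
    · obtain ⟨r, hr1, hrc⟩ := ENNReal.lt_iff_exists_nnreal_btwn.1 hc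
      have hr : (1 : ℝ) < r := by exact_mod_cast hr1
      filter_upwards [h (r - 1) (by linarith)] with b hb1
      refine lt_of_le_of_lt (limsup_le_of_le (h := ?_)) hrc
      filter_upwards [hb1, eventually_ge_atTop 0] with x hx hx0
      rw [← ENNReal.ofReal_coe_nnreal]
      refine ENNReal.ofReal_le_ofReal ?_
      rw [div_le_iff₀ (hb.tail_pos x hx0)]
      refine (real_le_mul_iff r.coe_nonneg).2 ?_
      rwa [show 1 + ((r : ℝ) - 1) = r by ring] at hx

/-- The comparison for `V` holds from some `T` on, hence for `θ ≤ x / T`; the remaining multipliers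
have mass negligible against the product tail. -/
lemma ConsistentlyVarying.mconv [IsProbabilityMeasure Q] (hV : ConsistentlyVarying V)
    (hQ0 : Q (Iio 0) = 0) (hQ : 0 < Q (Ioi 0)) (hneg : NegligibleTail Q (Measure.mconv Q V)) :
    ConsistentlyVarying (Measure.mconv Q V) := by
  obtain ⟨hb, hV⟩ := consistentlyVarying_iff.1 hV
  have := hb.isProbabilityMeasure
  refine consistentlyVarying_iff.2 ⟨hb.mconv hQ0 hQ, fun ε hε => ?_⟩
  filter_upwards [hV (ε / 2) (by positivity), Ioo_mem_nhdsLT (zero_lt_one (α := ℝ))] with b h hb01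
  obtain ⟨T, hT, hT'⟩ := ((eventually_gt_atTop (0 : ℝ)).and
    (eventually_forall_ge_atTop.2 h)).exists
  have hn := (isLittleO_tail_iff (V := Q) (s := fun x => Ioi (T⁻¹ * x))).1
    (hneg T⁻¹ (inv_pos.2 hT)) (ε / 2) (by positivity)
  filter_upwards [eventually_gt_atTop 0, hn] with x hx hxn
  have hg := measurable_measure_setOf_mul_mem (V := V) (measurableSet_Ioi (a := x))
  calc Measure.mconv Q V (Ioi (b * x)) = ∫⁻ θ, V {y | θ * y ∈ Ioi (b * x)} ∂Q :=
        mconv_apply_eq_lintegral measurableSet_Ioi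
    _ ≤ ∫⁻ θ, (ENNReal.ofReal (1 + ε / 2) * V {y | θ * y ∈ Ioi x} +
        (Ioi (T⁻¹ * x)).indicator (fun _ => 1) θ) ∂Q := by
      refine lintegral_mono fun θ => ?_
      dsimp only
      rcases le_or_gt θ 0 with hθ | hθ
      · rw [hb.measure_setOf_mul_mem_eq_zero hθ (Ioi_subset_Ioi (mul_pos hb01.1 hx).le)]
        exact zero_le
      rcases le_or_gt θ (T⁻¹ * x) with hθT | hθT
      · refine le_add_right ?_
        rw [setOf_mul_mem_Ioi hθ, setOf_mul_mem_Ioi hθ, mul_div_assoc]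
        refine hT' _ ((le_div_iff₀ hθ).2 ?_)
        rwa [inv_mul_eq_div, le_div_iff₀ hT, mul_comm] at hθT
      · rw [indicator_of_mem (show θ ∈ Ioi (T⁻¹ * x) from hθT)]
        exact le_add_left prob_le_one
    _ = ENNReal.ofReal (1 + ε / 2) * Measure.mconv Q V (Ioi x) + Q (Ioi (T⁻¹ * x)) := by
      rw [lintegral_add_left (hg.const_mul _), lintegral_const_mul _ hg,
        ← mconv_apply_eq_lintegral measurableSet_Ioi, lintegral_indicator_const measurableSet_Ioi,
        one_mul]
    _ ≤ ENNReal.ofReal (1 + ε / 2) * Measure.mconv Q V (Ioi x) +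
        ENNReal.ofReal (ε / 2) * Measure.mconv Q V (Ioi x) := by gcongr
    _ = ENNReal.ofReal (1 + ε) * Measure.mconv Q V (Ioi x) := by
      rw [← add_mul, ← ENNReal.ofReal_add (by positivity) (by positivity)]
      congr 2
      ring

end DominatedConsistent

/-! ### Joint exceedance of two independent products. -/

section SubexponentialProduct

variable {Q V : Measure ℝ}

/-- Two independent products, conditioned on the two multipliers. -/
lemma mconv_prod_mconv_apply [SFinite Q] [SFinite V] {S : Set (ℝ × ℝ)} (hS : MeasurableSet S) :
    (Measure.mconv Q V).prod (Measure.mconv Q V) S =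
      ∫⁻ θ, (V.prod V) {p | (θ.1 * p.1, θ.2 * p.2) ∈ S} ∂(Q.prod Q) := by
  have hm : Measurable fun p : ℝ × ℝ => p.1 * p.2 := by fun_prop
  have hA : MeasurableSet {q : (ℝ × ℝ) × (ℝ × ℝ) | (q.1.1 * q.2.1, q.1.2 * q.2.2) ∈ S} :=
    (show Measurable fun q : (ℝ × ℝ) × (ℝ × ℝ) => (q.1.1 * q.2.1, q.1.2 * q.2.2) by fun_prop) hS
  have hL : (Measure.mconv Q V).prod (Measure.mconv Q V) S =
      ∫⁻ θ₁, ∫⁻ y₁, ∫⁻ θ₂, V {y₂ | (θ₁ * y₁, θ₂ * y₂) ∈ S} ∂Q ∂V ∂Q := by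
    rw [Measure.mconv, Measure.map_prod_map _ _ hm hm, Measure.map_apply (by fun_prop) hS,
      Measure.prod_apply ((hm.prodMap hm) hS),
      lintegral_prod _ (measurable_measure_prodMk_left ((hm.prodMap hm) hS)).aemeasurable]
    refine lintegral_congr fun θ₁ => lintegral_congr fun y₁ => ?_
    rw [Measure.prod_apply (measurable_prodMk_left ((hm.prodMap hm) hS))]
    rfl
  rw [hL, lintegral_prod (fun θ : ℝ × ℝ => (V.prod V) {p | (θ.1 * p.1, θ.2 * p.2) ∈ S})
    (measurable_measure_prodMk_left (ν := V.prod V) hA).aemeasurable]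
  refine lintegral_congr fun θ₁ => ?_
  rw [lintegral_lintegral_swap]
  · refine lintegral_congr fun θ₂ => ?_
    have hC : MeasurableSet {p : ℝ × ℝ | (θ₁ * p.1, θ₂ * p.2) ∈ S} :=
      (show Measurable fun p : ℝ × ℝ => (θ₁ * p.1, θ₂ * p.2) by fun_prop) hS
    rw [Measure.prod_apply hC]
    rfl
  · have hC : MeasurableSet {q : (ℝ × ℝ) × ℝ | (θ₁ * q.1.1, q.1.2 * q.2) ∈ S} :=
      (show Measurable fun q : (ℝ × ℝ) × ℝ => (θ₁ * q.1.1, q.1.2 * q.2) by fun_prop) hS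
    exact (measurable_measure_prodMk_left (ν := V) hC).aemeasurable

/-- Splitting the maximum into a sum lets the bound integrate to twice the tail of the product. -/
lemma measure_Ioi_div_max_le (V : Measure ℝ) {θ₁ θ₂ x : ℝ} (h₁ : 0 < θ₁) (h₂ : 0 < θ₂) :
    V (Ioi (x / max θ₁ θ₂)) ≤ V {y | θ₁ * y ∈ Ioi x} + V {y | θ₂ * y ∈ Ioi x} := by
  rw [setOf_mul_mem_Ioi h₁, setOf_mul_mem_Ioi h₂]
  rcases max_choice θ₁ θ₂ with h | h <;> rw [h]
  · exact le_add_right le_rfl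
  · exact le_add_left le_rfl

lemma div_max_lt_add {θ₁ θ₂ x a b : ℝ} (h₁ : 0 < θ₁) (ha : 0 ≤ a) (hb : 0 ≤ b)
    (h : x < θ₁ * a + θ₂ * b) : x / max θ₁ θ₂ < a + b := by
  have hm : 0 < max θ₁ θ₂ := lt_max_of_lt_left h₁
  rw [div_lt_iff₀ hm]
  nlinarith [mul_le_mul_of_nonneg_right (le_max_left θ₁ θ₂) ha,
    mul_le_mul_of_nonneg_right (le_max_right θ₁ θ₂) hb]

/-- The part of the joint exceedance event of the products `θ₁ y₁`, `θ₂ y₂` on which `y₁` is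
small. -/
def smallFirst (K K₀ x θ₁ θ₂ : ℝ) : Set (ℝ × ℝ) :=
  {p | (θ₁ * p.1, θ₂ * p.2) ∈ jointExceed K x ∧ 0 ≤ p.1 ∧ 0 ≤ p.2 ∧ p.1 ≤ K₀}

lemma measurableSet_smallFirst (K K₀ x θ₁ θ₂ : ℝ) :
    MeasurableSet (smallFirst K K₀ x θ₁ θ₂) :=
  ((show Measurable fun p : ℝ × ℝ => (θ₁ * p.1, θ₂ * p.2) by fun_prop)
    (measurableSet_jointExceed K x)).inter
    ((measurableSet_le measurable_const measurable_fst).inter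
      ((measurableSet_le measurable_const measurable_snd).inter
        (measurableSet_le measurable_fst measurable_const)))

/-- Since `y₁ ≤ K₀` and `θ₁ * y₁ > K ≥ M * K₀`, the multiplier `θ₁` exceeds `M`. If `θ₂ > L`, a
crude bound on the sum suffices, as both multipliers exceed `L`. If `θ₂ ≤ L`, then `y₂ > K / L`; and
when `θ₁ < x / (2 * K₀)` the first product is below `x / 2`, so `y₂ > x / (2 * L)`. -/
lemma measure_smallFirst_le [IsProbabilityMeasure V] {C : ℝ≥0∞} {K K₀ L M x θ₁ θ₂ : ℝ}
    (hC : ∀ x, 0 ≤ x → (V.prod V) {p | x < p.1 + p.2} ≤ C * V (Ioi x))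
    (hK₀ : 0 < K₀) (hL : 0 < L) (hLM : L ≤ M) (hMK : M * K₀ ≤ K) (hx : 0 < x)
    (h₁ : 0 < θ₁) (h₂ : 0 < θ₂) :
    (V.prod V) (smallFirst K K₀ x θ₁ θ₂) ≤
      C * (V {y | θ₁ * y ∈ Ioi x} * (Ioi L).indicator 1 θ₂ +
        (Ioi L).indicator 1 θ₁ * V {y | θ₂ * y ∈ Ioi x}) +
      ((Ici (x / (2 * K₀))).indicator (fun _ => V (Ioi (K / L))) θ₁ +
        (Ioi M).indicator (fun _ => V (Ioi (x / (2 * L)))) θ₁) := by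
  rcases le_or_gt θ₁ M with hθM | hθM
  · have hempty : smallFirst K K₀ x θ₁ θ₂ = ∅ := by
      refine eq_empty_of_forall_notMem fun p hp => ?_
      have h3 : K < θ₁ * p.1 := hp.1.2.1
      have h4 := mul_le_mul hθM hp.2.2.2 hp.2.1 (h₁.le.trans hθM)
      linarith
    rw [hempty, measure_empty]
    exact zero_le
  rcases lt_or_ge L θ₂ with hθL | hθL
  · refine le_add_right ?_
    rw [indicator_of_mem (show θ₂ ∈ Ioi L from hθL),
      indicator_of_mem (show θ₁ ∈ Ioi L from hLM.trans_lt hθM), Pi.one_apply, Pi.one_apply,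
      mul_one, one_mul]
    refine le_trans ?_ (mul_le_mul_right (measure_Ioi_div_max_le V h₁ h₂) C)
    refine (measure_mono fun p hp => ?_).trans
      (hC _ (div_nonneg hx.le (h₁.le.trans (le_max_left _ _))))
    exact div_max_lt_add h₁ hp.2.1 hp.2.2.1 hp.1.1
  refine le_add_left ?_
  have hrect : ∀ {z : ℝ}, smallFirst K K₀ x θ₁ θ₂ ⊆ univ ×ˢ Ioi z →
      (V.prod V) (smallFirst K K₀ x θ₁ θ₂) ≤ V (Ioi z) := fun {z} h => by
    refine (measure_mono h).trans ?_
    rw [Measure.prod_prod, measure_univ, one_mul]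
  rcases le_or_gt (x / (2 * K₀)) θ₁ with hθx | hθx
  · rw [indicator_of_mem (show θ₁ ∈ Ici (x / (2 * K₀)) from hθx)]
    refine le_add_right (hrect fun p hp => ⟨mem_univ _, ?_⟩)
    have h3 : K < θ₂ * p.2 := hp.1.2.2
    have h4 := mul_le_mul_of_nonneg_right hθL hp.2.2.1
    rw [mem_Ioi, div_lt_iff₀ hL]
    linarith
  · rw [indicator_of_mem (show θ₁ ∈ Ioi M from hθM)]
    refine le_add_left (hrect fun p hp => ⟨mem_univ _, ?_⟩)
    have h3 : x < θ₁ * p.1 + θ₂ * p.2 := hp.1.1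
    have h4 := mul_le_mul_of_nonneg_right hθL hp.2.2.1
    have h5 := mul_le_mul_of_nonneg_left hp.2.2.2 h₁.le
    rw [lt_div_iff₀ (by positivity)] at hθx
    rw [mem_Ioi, div_lt_iff₀ (by positivity)]
    linarith

/-- Either both `y`'s exceed `K₀`, where joint exceedance for `V` applies at level `x / max θ₁ θ₂`,
or one of them is small, which `measure_smallFirst_le` covers up to swapping coordinates. -/
lemma measure_setOf_mul_mem_jointExceed_le (hb : IsBase V) {e C : ℝ≥0∞} {K K₀ L M x : ℝ}
    (hC : ∀ x, 0 ≤ x → (V.prod V) {p | x < p.1 + p.2} ≤ C * V (Ioi x))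
    (he : ∀ x, (V.prod V) (jointExceed K₀ x) ≤ e * V (Ioi x))
    (hK₀ : 0 < K₀) (hL : 0 < L) (hLM : L ≤ M) (hMK : M * K₀ ≤ K) (hx : 0 < x) (θ₁ θ₂ : ℝ) :
    (V.prod V) {p | (θ₁ * p.1, θ₂ * p.2) ∈ jointExceed K x} ≤
      (e * (V {y | θ₁ * y ∈ Ioi x} + V {y | θ₂ * y ∈ Ioi x})) +
      2 * (C * (V {y | θ₁ * y ∈ Ioi x} * (Ioi L).indicator 1 θ₂ +
        (Ioi L).indicator 1 θ₁ * V {y | θ₂ * y ∈ Ioi x})) +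
      (((Ici (x / (2 * K₀))).indicator (fun _ => V (Ioi (K / L))) θ₁ +
        (Ioi M).indicator (fun _ => V (Ioi (x / (2 * L)))) θ₁) +
      ((Ici (x / (2 * K₀))).indicator (fun _ => V (Ioi (K / L))) θ₂ +
        (Ioi M).indicator (fun _ => V (Ioi (x / (2 * L)))) θ₂)) := by
  have := hb.isProbabilityMeasure
  have hK : 0 < K := (mul_pos (hL.trans_le hLM) hK₀).trans_le hMK
  have hnonneg : ∀ᵐ p ∂(V.prod V), 0 ≤ p.1 ∧ 0 ≤ p.2 :=
    (Measure.quasiMeasurePreserving_fst.ae hb.ae_nonneg).and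
      (Measure.quasiMeasurePreserving_snd.ae hb.ae_nonneg)
  by_cases hθ : 0 < θ₁ ∧ 0 < θ₂
  · obtain ⟨h₁, h₂⟩ := hθ
    have hswap : (V.prod V) (Prod.swap ⁻¹' smallFirst K K₀ x θ₂ θ₁) =
        (V.prod V) (smallFirst K K₀ x θ₂ θ₁) :=
      (Measure.measurePreserving_swap (μ := V) (ν := V)).measure_preimage
        (measurableSet_smallFirst _ _ _ _ _).nullMeasurableSet
    have hcov : {p : ℝ × ℝ | (θ₁ * p.1, θ₂ * p.2) ∈ jointExceed K x} ≤ᵐ[V.prod V]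
        (jointExceed K₀ (x / max θ₁ θ₂) ∪
          (smallFirst K K₀ x θ₁ θ₂ ∪ Prod.swap ⁻¹' smallFirst K K₀ x θ₂ θ₁) : Set (ℝ × ℝ)) := by
      filter_upwards [hnonneg] with p hp hpJ
      by_cases h3 : p.1 ≤ K₀
      · exact Or.inr (Or.inl ⟨hpJ, hp.1, hp.2, h3⟩)
      by_cases h4 : p.2 ≤ K₀
      · refine Or.inr (Or.inr ⟨⟨?_, hpJ.2.2, hpJ.2.1⟩, hp.2, hp.1, h4⟩)
        have : x < θ₁ * p.1 + θ₂ * p.2 := hpJ.1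
        rwa [add_comm] at this
      · exact Or.inl ⟨div_max_lt_add h₁ hp.1 hp.2 hpJ.1, not_le.1 h3, not_le.1 h4⟩
    refine (measure_mono_ae hcov).trans ((measure_union_le _ _).trans
      (add_le_add ((he _).trans (mul_le_mul_right (measure_Ioi_div_max_le V h₁ h₂) e))
        ((measure_union_le _ _).trans (add_le_add
          (measure_smallFirst_le hC hK₀ hL hLM hMK hx h₁ h₂)
          (hswap.le.trans (measure_smallFirst_le hC hK₀ hL hLM hMK hx h₂ h₁))))) |>.trans
          (le_of_eq ?_))
    ring
  · refine le_trans (le_of_eq ?_) zero_le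
    refine measure_eq_zero_iff_ae_notMem.2 ?_
    filter_upwards [hnonneg] with p hp hpJ
    have h3 : K < θ₁ * p.1 := hpJ.2.1
    have h4 : K < θ₂ * p.2 := hpJ.2.2
    refine hθ ⟨?_, ?_⟩
    · by_contra h
      linarith [mul_nonpos_of_nonpos_of_nonneg (not_lt.1 h) hp.1]
    · by_contra h
      linarith [mul_nonpos_of_nonpos_of_nonneg (not_lt.1 h) hp.2]

/-- Comparison with the mass beyond `a`, not with a constant, keeps this valid when the support is
bounded. -/
lemma exists_measure_Ioi_le_mul (Q : Measure ℝ) [IsFiniteMeasure Q] {a : ℝ} {e : ℝ≥0∞}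
    (he : 0 < e) : ∃ M ≥ a, Q (Ioi M) ≤ e * Q (Ioi a) := by
  rcases eq_or_ne (Q (Ioi a)) 0 with h | h
  · exact ⟨a, le_rfl, by rw [h, mul_zero]⟩
  · obtain ⟨M, hM, hMa⟩ := (((tendsto_measure_Ioi_atTop Q).eventually
      (gt_mem_nhds (ENNReal.mul_pos he.ne' h))).and (eventually_ge_atTop a)).exists
    exact ⟨M, hMa, hM.le⟩

lemma Subexponential.exists_jointExceed_mconv_le [IsProbabilityMeasure Q]
    (hV : Subexponential V) {ε : ℝ} (hε : 0 < ε) :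
    ∃ K > 0, ∀ x, 0 < x → ((Measure.mconv Q V).prod (Measure.mconv Q V)) (jointExceed K x) ≤
      ENNReal.ofReal ε * Measure.mconv Q V (Ioi x) := by
  have hb := hV.1
  have := hb.isProbabilityMeasure
  -- The constant is `2 + 4 + 4`: both `y`'s large, both multipliers above `L`, and the two
  -- remaining cases, each counted twice.
  obtain ⟨r, hr, rfl⟩ : ∃ r > 0, 10 * r = ε := ⟨ε / 10, by positivity, by ring⟩
  set e := ENNReal.ofReal r with he
  have he0 : 0 < e := ENNReal.ofReal_pos.2 hr
  obtain ⟨K₀, hK₀, hJ⟩ := hV.exists_jointExceed_le hr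
  obtain ⟨c, hc, hC⟩ := hV.exists_sum_le
  set C := ENNReal.ofReal c with hCdef
  have hQL : ∀ᶠ L in atTop, C * Q (Ioi L) < e := by
    have h := ENNReal.Tendsto.const_mul (a := C) (tendsto_measure_Ioi_atTop Q)
      (Or.inr ENNReal.ofReal_ne_top)
    rw [mul_zero] at h
    exact h.eventually (gt_mem_nhds he0)
  obtain ⟨L, hLC, hL⟩ := (hQL.and (eventually_gt_atTop 0)).exists
  obtain ⟨M, hLM, hM⟩ := exists_measure_Ioi_le_mul Q (a := 2 * L) he0
  obtain ⟨N, hN, hVN⟩ := exists_measure_Ioi_le_mul V (a := 2 * K₀) he0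
  -- The first entry forces a large multiplier when its `y` is at most `K₀`; the second gives `K / L
  -- ≥ N`.
  set K := max (M * K₀) (N * L) with hKdef
  have hM0 : 0 < M := by linarith
  have hMK : M * K₀ ≤ K := le_max_left _ _
  have hVK : V (Ioi (K / L)) ≤ e * V (Ioi (2 * K₀)) :=
    (measure_mono (Ioi_subset_Ioi ((le_div_iff₀ hL).2 (le_max_right _ _)))).trans hVN
  refine ⟨K, (mul_pos hM0 hK₀).trans_le hMK, fun x hx => ?_⟩
  set H := Measure.mconv Q V with hH
  set g : ℝ → ℝ≥0∞ := fun θ => V {y | θ * y ∈ Ioi x} with hgdef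
  have hg : Measurable g := measurable_measure_setOf_mul_mem measurableSet_Ioi
  have hgH : ∫⁻ θ, g θ ∂Q = H (Ioi x) := (mconv_apply_eq_lintegral measurableSet_Ioi).symm
  set l : ℝ → ℝ≥0∞ := (Ioi L).indicator 1 with hldef
  have hl : Measurable l := measurable_one.indicator measurableSet_Ioi
  have hlQ : ∫⁻ θ, l θ ∂Q = Q (Ioi L) := lintegral_indicator_one measurableSet_Ioi
  set u : ℝ → ℝ≥0∞ := fun θ => (Ici (x / (2 * K₀))).indicator (fun _ => V (Ioi (K / L))) θ +
    (Ioi M).indicator (fun _ => V (Ioi (x / (2 * L)))) θ with hudef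
  have hu : Measurable u := (measurable_const.indicator measurableSet_Ici).add
    (measurable_const.indicator measurableSet_Ioi)
  have huQ : ∫⁻ θ, u θ ∂Q ≤ 2 * (e * H (Ioi x)) := by
    rw [hudef, lintegral_add_left (measurable_const.indicator measurableSet_Ici),
      lintegral_indicator_const measurableSet_Ici, lintegral_indicator_const measurableSet_Ioi,
      two_mul (e * _)]
    refine add_le_add ?_ ?_
    · calc V (Ioi (K / L)) * Q (Ici (x / (2 * K₀)))
          ≤ (e * V (Ioi (2 * K₀))) * Q (Ici (x / (2 * K₀))) := by gcongr
        _ = e * (Q (Ici (x / (2 * K₀))) * V (Ioi (2 * K₀))) := by ring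
        _ ≤ e * H (Ioi x) := by
          gcongr
          refine mul_le_mconv measurableSet_Ioi fun θ hθ y hy => ?_
          have hθ0 : 0 < θ := lt_of_lt_of_le (by positivity) hθ
          rw [mem_Ici, div_le_iff₀ (by positivity)] at hθ
          rw [mem_Ioi] at hy ⊢
          nlinarith
    · calc V (Ioi (x / (2 * L))) * Q (Ioi M) ≤ V (Ioi (x / (2 * L))) * (e * Q (Ioi (2 * L))) := by
            gcongr
        _ = e * (Q (Ioi (2 * L)) * V (Ioi (x / (2 * L)))) := by ring
        _ ≤ e * H (Ioi x) := by
          gcongr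
          refine mul_le_mconv measurableSet_Ioi fun θ hθ y hy => ?_
          have hy0 : 0 < y := lt_trans (by positivity) hy
          rw [mem_Ioi, div_lt_iff₀ (by positivity)] at hy
          rw [mem_Ioi] at hθ ⊢
          nlinarith
  have h1 : ∀ {f : ℝ → ℝ≥0∞}, Measurable f → ∫⁻ θ, f θ.1 ∂(Q.prod Q) = ∫⁻ θ, f θ ∂Q :=
    fun hf => measurePreserving_fst.lintegral_comp hf
  have h2 : ∀ {f : ℝ → ℝ≥0∞}, Measurable f → ∫⁻ θ, f θ.2 ∂(Q.prod Q) = ∫⁻ θ, f θ ∂Q :=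
    fun hf => measurePreserving_snd.lintegral_comp hf
  have hg1 : Measurable fun θ : ℝ × ℝ => g θ.1 := hg.comp measurable_fst
  have hg2 : Measurable fun θ : ℝ × ℝ => g θ.2 := hg.comp measurable_snd
  have hu1 : Measurable fun θ : ℝ × ℝ => u θ.1 := hu.comp measurable_fst
  have hgl : Measurable fun θ : ℝ × ℝ => g θ.1 * l θ.2 := hg1.mul (hl.comp measurable_snd)
  have hlg : Measurable fun θ : ℝ × ℝ => l θ.1 * g θ.2 := (hl.comp measurable_fst).mul hg2
  have hgg : Measurable fun θ : ℝ × ℝ => g θ.1 + g θ.2 := hg1.add hg2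
  have hs : Measurable fun θ : ℝ × ℝ => g θ.1 * l θ.2 + l θ.1 * g θ.2 := hgl.add hlg
  have hCs : Measurable fun θ : ℝ × ℝ => C * (g θ.1 * l θ.2 + l θ.1 * g θ.2) := hs.const_mul C
  have hegg : Measurable fun θ : ℝ × ℝ => e * (g θ.1 + g θ.2) := hgg.const_mul e
  have hsum : Measurable fun θ : ℝ × ℝ =>
      e * (g θ.1 + g θ.2) + 2 * (C * (g θ.1 * l θ.2 + l θ.1 * g θ.2)) :=
    hegg.add (hCs.const_mul 2)
  rw [mconv_prod_mconv_apply (measurableSet_jointExceed K x)]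
  calc _ ≤ ∫⁻ θ : ℝ × ℝ, (e * (g θ.1 + g θ.2) + 2 * (C * (g θ.1 * l θ.2 + l θ.1 * g θ.2)) +
          (u θ.1 + u θ.2)) ∂(Q.prod Q) :=
        lintegral_mono fun θ => measure_setOf_mul_mem_jointExceed_le hb hC hJ hK₀ hL
          (by linarith) hMK hx θ.1 θ.2
    _ = e * (H (Ioi x) + H (Ioi x)) +
          2 * (C * (H (Ioi x) * Q (Ioi L) + Q (Ioi L) * H (Ioi x))) +
          (∫⁻ θ, u θ ∂Q + ∫⁻ θ, u θ ∂Q) := by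
      rw [lintegral_add_left hsum, lintegral_add_left hegg, lintegral_const_mul _ hgg,
        lintegral_const_mul _ hCs, lintegral_const_mul _ hs, lintegral_add_left hg1,
        lintegral_add_left hgl, lintegral_add_left hu1, h1 hg, h2 hg, h1 hu, h2 hu,
        lintegral_prod_mul hg.aemeasurable hl.aemeasurable,
        lintegral_prod_mul hl.aemeasurable hg.aemeasurable, hgH, hlQ]
    _ = 2 * e * H (Ioi x) + 4 * (C * Q (Ioi L)) * H (Ioi x) + 2 * ∫⁻ θ, u θ ∂Q := by ring
    _ ≤ 2 * e * H (Ioi x) + 4 * e * H (Ioi x) + 2 * (2 * (e * H (Ioi x))) := by gcongr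
    _ = ENNReal.ofReal (10 * r) * H (Ioi x) := by
      rw [ENNReal.ofReal_mul (by norm_num), ← he]
      norm_num
      ring

/-- If one factor is subexponential, then the product is subexponential as soon as it is
long-tailed. -/
lemma Subexponential.mconv [IsProbabilityMeasure Q] (hV : Subexponential V)
    (hH : LongTailed (Measure.mconv Q V)) : Subexponential (Measure.mconv Q V) := by
  refine hH.subexponential fun ε hε => ?_
  obtain ⟨K, hK, h⟩ := hV.exists_jointExceed_mconv_le (Q := Q) hε
  exact ⟨K, hK, (eventually_gt_atTop 0).mono h⟩

end SubexponentialProduct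

/-! ### The atom criterion. -/

section Criteria

variable {Q V : Measure ℝ}

lemma atomCondition_iff {D : Set ℝ} {H : Measure ℝ} : AtomCondition D Q H ↔ ∀ t ∈ D,
    (fun x : ℝ => tail Q (x / t) - tail Q ((x + 1) / t)) =o[atTop] (fun x : ℝ => tail H x) := by
  constructor
  · rintro (rfl | ⟨-, h⟩)
    · simp
    · exact h
  · intro h
    rcases D.eq_empty_or_nonempty with hD | hD
    · exact Or.inl hD
    · exact Or.inr ⟨hD, h⟩

/-- The increment at scale `t` is at most `tail Q (x / t)`. Since `V` is arbitrary, this serves both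
the atoms of `F_A` and those of `Q`. -/
lemma NegligibleTail.atomCondition [IsFiniteMeasure Q] {H : Measure ℝ} (h : NegligibleTail Q H)
    (V : Measure ℝ) : AtomCondition (posAtoms V) Q H := by
  refine atomCondition_iff.2 fun t ht => ?_
  refine IsBigO.trans_isLittleO ?_ (h t⁻¹ (inv_pos.2 ht.1))
  refine IsBigO.of_bound 1 (Eventually.of_forall fun x => ?_)
  have ht0 := ht.1
  have hxt : x / t ≤ (x + 1) / t := by gcongr; linarith
  rw [one_mul, Real.norm_of_nonneg (sub_nonneg.2 (tail_anti Q hxt)),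
    Real.norm_of_nonneg (tail_nonneg _ _), inv_mul_eq_div]
  linarith [tail_nonneg Q ((x + 1) / t)]

lemma Subexponential.mconv_iff [IsProbabilityMeasure Q] (hV : Subexponential V)
    (hQ0 : Q (Iio 0) = 0) (hQ : 0 < Q (Ioi 0)) :
    Subexponential (Measure.mconv Q V) ↔ AtomCondition (posAtoms V) Q (Measure.mconv Q V) := by
  have := hV.1.isProbabilityMeasure
  rw [atomCondition_iff]
  exact ⟨fun h t ht => h.longTailed.isLittleO_of_mconv ht,
    fun h => hV.mconv (hV.longTailed.mconv hQ0 hQ h)⟩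

end Criteria

/-! ### Homogeneity of the gauge and reduction to one dimension. -/

section Gauge

variable {d : ℕ} {A : Set (Fin d → ℝ)}

/-- The set of admissible `u` is `{0}` or empty; the supremum is `0` either way. -/
lemma MemR.gaugeSup_zero (hA : MemR A) : gaugeSup A 0 = 0 := by
  have h : ∀ u ∈ {u : ℝ | (0 : Fin d → ℝ) ∈ u • A}, u = 0 := by
    intro u hu
    by_contra hu0
    have h1 := (mem_smul_set_iff_inv_smul_mem₀ hu0 A 0).1 hu
    rw [smul_zero] at h1
    exact hA.zero_notMem (subset_closure h1)
  exact le_antisymm (Real.sSup_nonpos fun u hu => (h u hu).le)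
    (Real.sSup_nonneg fun u hu => (h u hu).ge)

lemma MemR.gaugeSup_smul (hA : MemR A) {θ : ℝ} (hθ : 0 ≤ θ) (x : Fin d → ℝ) :
    gaugeSup A (θ • x) = θ * gaugeSup A x := by
  rcases hθ.eq_or_lt with rfl | hθ
  · rw [zero_smul, hA.gaugeSup_zero, zero_mul]
  · rw [gaugeSup, gaugeSup, ← smul_eq_mul, ← Real.sSup_smul_of_nonneg hθ.le]
    congr 1
    ext u
    rw [mem_smul_set_iff_inv_smul_mem₀ hθ.ne', mem_ofPred_eq, mem_ofPred_eq, smul_assoc,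
      mem_inv_smul_set_iff₀ hθ.ne']

/-- Along `A`, the law of a randomly scaled vector is the law of the product of the scale and the
gauge of the vector. -/
lemma MemR.lawAlong_map_smul (hA : MemR A) {Ω : Type*} [MeasurableSpace Ω] {P : Measure Ω}
    [IsProbabilityMeasure P] {X : Ω → Fin d → ℝ} {Θ : Ω → ℝ} (hX : AEMeasurable X P)
    (hΘ : AEMeasurable Θ P) (hΘ0 : ∀ᵐ ω ∂P, 0 ≤ Θ ω) (hind : IndepFun Θ X P) :
    lawAlong A (P.map fun ω => Θ ω • X ω) =
      Measure.mconv (P.map Θ) (lawAlong A (P.map X)) := by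
  have hg := hA.measurable_gaugeSup
  have hY : AEMeasurable (gaugeSup A ∘ X) P := hg.comp_aemeasurable hX
  have hZ : AEMeasurable (fun ω => Θ ω • X ω) P := hΘ.smul hX
  have hprod := (indepFun_iff_map_prod_eq_prod_map_map hΘ hY).1
    (hind.comp (measurable_id (α := ℝ)) hg)
  rw [lawAlong, lawAlong, AEMeasurable.map_map_of_aemeasurable hg.aemeasurable hZ,
    AEMeasurable.map_map_of_aemeasurable hg.aemeasurable hX, Measure.mconv, ← hprod,
    AEMeasurable.map_map_of_aemeasurable (by fun_prop) (hΘ.prodMk hY)]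
  refine Measure.map_congr ?_
  filter_upwards [hΘ0] with ω hω
  exact hA.gaugeSup_smul hω (X ω)

end Gauge

end HeavyTail

theorem mainTheorem6 {d : ℕ} (A : Set (Fin d → ℝ)) (hA : HeavyTail.MemR A)
    {Ω : Type*} [MeasurableSpace Ω] (P : Measure Ω) [IsProbabilityMeasure P]
    (X : Ω → Fin d → ℝ) (Θ : Ω → ℝ) (hX : AEMeasurable X P) (hΘ : AEMeasurable Θ P)
    (hX0 : ∀ᵐ ω ∂P, ∀ i, 0 ≤ X ω i) (hΘ0 : ∀ᵐ ω ∂P, 0 ≤ Θ ω)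
    (hΘne : ¬ ∀ᵐ ω ∂P, Θ ω = 0) (hind : IndepFun Θ X P)
    (F G : Measure (Fin d → ℝ)) (Q : Measure ℝ)
    (hF : F = P.map X) (hG : G = P.map (fun ω => Θ ω • X ω)) (hQ : Q = P.map Θ) :
    -- closure of the three classes and the criterion for `𝒮_A`, when the tail of `Θ` is negligible
    (HeavyTail.NegligibleTail Q (HeavyTail.lawAlong A G) →
      (HeavyTail.MemL A F → HeavyTail.MemL A G) ∧
      (HeavyTail.MemDL A F → HeavyTail.MemDL A G) ∧
      (HeavyTail.MemC A F → HeavyTail.MemC A G) ∧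
      (HeavyTail.MemS A F →
        (HeavyTail.MemS A G ↔
          HeavyTail.AtomCondition (HeavyTail.posAtoms Q) Q (HeavyTail.lawAlong A G)))) ∧
    -- the criterion for `𝒮_A` in terms of the atoms of `F_A`, under independence alone
    (HeavyTail.MemS A F →
      (HeavyTail.MemS A G ↔
        HeavyTail.AtomCondition (HeavyTail.posAtoms (HeavyTail.lawAlong A F)) Q
          (HeavyTail.lawAlong A G))) := by
  subst hF hG hQ
  have := Measure.isProbabilityMeasure_map (μ := P) hΘ
  have hQ0 : P.map Θ (Iio 0) = 0 := by
    rw [Measure.map_apply_of_aemeasurable hΘ measurableSet_Iio]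
    exact measure_mono_null (fun ω hω => not_le.2 hω) (ae_iff.1 hΘ0)
  have hQ : 0 < P.map Θ (Ioi 0) := by
    rw [Measure.map_apply_of_aemeasurable hΘ measurableSet_Ioi, pos_iff_ne_zero]
    intro h0
    refine hΘne ?_
    filter_upwards [hΘ0, measure_eq_zero_iff_ae_notMem.1 h0] with ω h1 h2
    exact le_antisymm (not_lt.1 h2) h1
  unfold HeavyTail.MemL HeavyTail.MemDL HeavyTail.MemC HeavyTail.MemS
  rw [hA.lawAlong_map_smul hX hΘ hΘ0 hind]
  refine ⟨fun hneg => ⟨fun h => ?_, fun h => ⟨h.1.mconv hQ0 hQ, ?_⟩,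
    fun h => h.mconv hQ0 hQ hneg, fun h => ?_⟩, fun h => h.mconv_iff hQ0 hQ⟩
  · exact h.mconv hQ0 hQ (HeavyTail.atomCondition_iff.1 (hneg.atomCondition _))
  · exact h.2.mconv hQ0 hQ (HeavyTail.atomCondition_iff.1 (hneg.atomCondition _))
  -- The left side comes from the criterion for the atoms of `F_A`, the right side directly from
  -- negligibility.
  · exact iff_of_true ((h.mconv_iff hQ0 hQ).2 (hneg.atomCondition _)) (hneg.atomCondition _)
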